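/- **Setting.** A quantum circuit $\zeta$ on $n$ qubits is a sequence of $m$ layers, each layer being a set of two-qubit unitary gates on pairwise disjoint pairs of qubits; $m$ is its depth (single-qubit gates are not counted and are absorbed into the two-qubit gates). Let $G$ be a simple graph with $n$ vertices (the interaction graph). A compilation of $\zeta$ for $G$ consists of an initial placement of the $n$ qubits on the $n$ vertices (a bijection, so there are no ancillas) and a sequence of time steps. In each time step a set of pairwise disjoint edges of $G$ is selected, and the two qubits at the ends of each selected edge either are swapped or undergo a gate. The gates performed on the qubits must be exactly the gates of $\zeta$, and every qubit must undergo its gates in the order prescribed by $\zeta$. A compilation scheme $\chi$ for $G$ assigns such a compilation to every circuit $\zeta$ on $n$ qubits, and for $m\ge 1$ the depth overhead $D(G,\zeta,\chi)$ is the number of time steps of the compilation of $\zeta$ divided by $m$. **Theorem 3.1.** For every $r\ge 4$ there is a constant $C$ such that for every $n>r$ with $nr$ even there are an $r$-regular simple graph $G$ on $n$ vertices and a compilation scheme $\chi$ for $G$ such that, for every circuit $\zeta$ on $n$ qubits, the compiled circuit computes the same output state as $\zeta$ for every input state (up to the initial and final placement of the qubits on the vertices), and, if $\zeta$ has depth at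 least $1$, $$D(G,\zeta,\chi)\le C\log n .$$ -/

import Mathlib

namespace QRouting

/-- A two-qubit gate: a `4 × 4` unitary applied to an ordered pair of distinct qubits. -/
structure Gate (Q : Type*) where
  fst : Q
  snd : Q
  ne : fst ≠ snd
  U : Matrix.unitaryGroup (Fin 2 × Fin 2) ℂ

namespace Gate

variable {Q V : Type*}

/-- The gate acts on the qubit `q`. -/
def Touches (g : Gate Q) (q : Q) : Prop := g.fst = q ∨ g.snd = q

instance [DecidableEq Q] (g : Gate Q) (q : Q) : Decidable (g.Touches q) :=
  inferInstanceAs (Decidable (_ ∨ _))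

/-- The two gates act on disjoint pairs of qubits. -/
def Disjoint (g h : Gate Q) : Prop := ∀ q, ¬ (g.Touches q ∧ h.Touches q)

/-- The same gate after a relabelling of the wires. -/
def relabel (g : Gate Q) (e : Q ≃ V) : Gate V where
  fst := e g.fst
  snd := e g.snd
  ne := fun h => g.ne (e.injective h)
  U := g.U

end Gate

/-- A quantum circuit on the qubits `Q`: a sequence of layers, each consisting of two-qubit gates
on pairwise disjoint pairs of qubits. (Single-qubit gates do not count towards the depth and are
absorbed into the two-qubit gates.) -/
structure Circuit (Q : Type*) where
  layers : List (List (Gate Q))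
  disjoint : ∀ L ∈ layers, L.Pairwise Gate.Disjoint

/-- The depth of a circuit: its number of layers. This is the number of time steps that it takes on
a completely connected machine, where a layer takes one step. -/
def Circuit.depth {Q : Type*} (ζ : Circuit Q) : ℕ := ζ.layers.length

/-- All gates of a circuit, layer after layer. -/
def Circuit.gates {Q : Type*} (ζ : Circuit Q) : List (Gate Q) := ζ.layers.flatten

/-- What a pair of vertices of the machine can undergo in one time step: a swap or a gate. -/
inductive Op (V : Type*) where
  | swap (u v : V) (h : u ≠ v) : Op V
  | gate (g : Gate V) : Op V

namespace Op

variable {Q V : Type*}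

/-- One of the two vertices that the operation acts on. -/
def fst : Op V → V
  | swap u _ _ => u
  | gate g => g.fst

/-- The other vertex that the operation acts on. -/
def snd : Op V → V
  | swap _ v _ => v
  | gate g => g.snd

/-- The two operations act on disjoint pairs of vertices. -/
def Disjoint (o p : Op V) : Prop :=
  o.fst ≠ p.fst ∧ o.fst ≠ p.snd ∧ o.snd ≠ p.fst ∧ o.snd ≠ p.snd

variable [DecidableEq V]

/-- The position of every qubit after a sequence of operations, started from the positions `p`:
a swap exchanges the qubits at its two vertices, a gate moves nothing. -/
def positions (p : Q ≃ V) : List (Op V) → (Q ≃ V)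
  | [] => p
  | swap u v _ :: l => positions (p.trans (Equiv.swap u v)) l
  | gate _ :: l => positions p l

/-- The gates that a sequence of operations, started with the qubits at the positions `p`, performs
on the qubits, in order: a gate at two vertices acts on the qubits that are there at that time. -/
def performed (p : Q ≃ V) : List (Op V) → List (Gate Q)
  | [] => []
  | swap u v _ :: l => performed (p.trans (Equiv.swap u v)) l
  | gate g :: l => g.relabel p.symm :: performed p l

end Op

/-- A compilation of the circuit `ζ` for the machine with interaction graph `G`: an initial
configuration of the qubits and a sequence of time steps, each of which consists of swaps and gates
on pairwise disjoint edges of `G`, such that the gates performed are exactly those of `ζ`, each as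
often as in `ζ`, and every qubit undergoes its gates in the order that `ζ` prescribes. Gates of
different layers, and gates and swaps, may share a time step. -/
structure Compiled {Q V : Type*} [DecidableEq Q] [DecidableEq V]
    (G : SimpleGraph V) (ζ : Circuit Q) where
  init : Q ≃ V
  steps : List (List (Op V))
  on_edges : ∀ S ∈ steps, ∀ o ∈ S, G.Adj o.fst o.snd
  disjoint : ∀ S ∈ steps, S.Pairwise Op.Disjoint
  faithful : ∀ q : Q,
    (Op.performed init steps.flatten).filter (fun g => decide (g.Touches q)) =
      ζ.gates.filter (fun g => decide (g.Touches q))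

/-- The final positions of the qubits. -/
def Compiled.final {Q V : Type*} [DecidableEq Q] [DecidableEq V] {G : SimpleGraph V}
    {ζ : Circuit Q} (c : Compiled G ζ) : Q ≃ V :=
  Op.positions c.init c.steps.flatten

/-- A description of how to compile every circuit on the qubits `Q` for the interaction
graph `G`. -/
abbrev Scheme (Q : Type*) {V : Type*} [DecidableEq Q] [DecidableEq V] (G : SimpleGraph V) :=
  (ζ : Circuit Q) → Compiled G ζ

/-- The depth overhead: the factor by which the number of time steps grows when the circuit `ζ` is
run on the machine with interaction graph `G` in the way that `χ` describes. -/
noncomputable def depthOverhead {Q V : Type*} [DecidableEq Q] [DecidableEq V]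
    (G : SimpleGraph V) (ζ : Circuit Q) (χ : Scheme Q G) : ℝ :=
  ((χ ζ).steps.length : ℝ) / (ζ.depth : ℝ)

/-- State vectors of a register of qubits indexed by `Q`, in the computational basis. -/
abbrev State (Q : Type*) := (Q → Fin 2) → ℂ

/-- The state of the machine when the qubits are in the state `ψ` and sit at the positions `p`. -/
def place {Q V : Type*} (p : Q ≃ V) (ψ : State Q) : State V := fun x => ψ (x ∘ p)

section Semantics

variable {Q V : Type*} [DecidableEq Q] [DecidableEq V]

/-- The action of a gate on state vectors: `U` on the two tensor factors of the gate, the identity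
on all others. -/
noncomputable def Gate.apply (g : Gate Q) (ψ : State Q) : State Q := fun x =>
  ∑ s : Fin 2 × Fin 2, (g.U : Matrix (Fin 2 × Fin 2) (Fin 2 × Fin 2) ℂ) (x g.fst, x g.snd) s *
    ψ (Function.update (Function.update x g.fst s.1) g.snd s.2)

/-- The action of an operation on state vectors; a swap exchanges two tensor factors. -/
noncomputable def Op.apply (o : Op V) (ψ : State V) : State V :=
  match o with
  | .swap u v _ => fun x => ψ (x ∘ Equiv.swap u v)
  | .gate g => g.apply ψ

/-- The state that the circuit computes from the input state `ψ`. -/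
noncomputable def Circuit.run (ζ : Circuit Q) (ψ : State Q) : State Q :=
  ζ.gates.foldl (fun φ g => g.apply φ) ψ

/-- The state that the compiled circuit computes from the state `ψ` of the machine. -/
noncomputable def Compiled.run {G : SimpleGraph V} {ζ : Circuit Q} (c : Compiled G ζ)
    (ψ : State V) : State V :=
  c.steps.flatten.foldl (fun φ o => o.apply φ) ψ

end Semantics

end QRouting

/-! It suffices to simulate one layer in `O(log n)` steps. `RoutesPairings` isolates what the graph
must provide: a colouring of all pairs of vertices such that disjoint pairs of one colour can be
moved to edges by few swaps. With boundedly many colours, the gates of each colour are routed to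
edges, executed and routed back. Every such block returns all qubits to their places, so blocks
concatenate (`exists_scheme`); the order inside a layer is immaterial because disjoint gates
commute.

For large `n` the graph is built on the cube-connected paths `Core k`, which route every permutation
in `16 * k` steps (`Core.routable`). König's edge colouring factors a permutation into two column
permutations around one that preserves levels. The latter is a Beneš routing on all levels at once:
odd-even transposition carries every level past every dimension, and at each dimension a switch
before and a switch after settle one coordinate. Columns are paths, routed by leaving swaps out of
odd-even transposition (`routable_netEffect_mul`).

Hanging a tail of 2 to 8 vertices on every core vertex gives exactly `n` vertices and maximal degree
4. A pair is coloured by the heights of its two ends in their tails, so within a colour a tail holds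
at most one first end and at most one second end. These move to heights 0 and 1, and a core
permutation carries every first end below its partner (`Tailed.routesPairings`). Since `k` is `O(log
n)`, so is the overhead. An extremal edge-switching argument completes the graph to an `r`-regular
one (`exists_regular_supergraph`).

The remaining bounded `n` use a circulant graph with a Hamiltonian path; their cost goes into the
constant. -/

namespace QRouting

/-! ### Permutations achieved by parallel swaps. -/

open Equiv

variable {V V' : Type*}

/-- An involution that moves every vertex along an edge or not at all: what one time step of swaps
on pairwise disjoint edges can achieve. -/
def IsStep (G : SimpleGraph V) (τ : Perm V) : Prop :=
  ∀ v, τ (τ v) = v ∧ (τ v = v ∨ G.Adj v (τ v))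

/-- The permutation is achieved by `t` time steps of swaps. -/
inductive Routable (G : SimpleGraph V) : ℕ → Perm V → Prop
  | zero : Routable G 0 1
  | succ {t : ℕ} {τ σ : Perm V} : IsStep G τ → Routable G t σ → Routable G (t + 1) (τ * σ)

theorem isStep_one (G : SimpleGraph V) : IsStep G 1 := fun _ => ⟨rfl, Or.inl rfl⟩

theorem IsStep.inv_eq {G : SimpleGraph V} {τ : Perm V} (h : IsStep G τ) : τ⁻¹ = τ := by
  ext v
  rw [Perm.inv_eq_iff_eq]
  exact (h v).1.symm

namespace Routable

variable {G : SimpleGraph V}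

theorem zero_iff {σ : Perm V} : Routable G 0 σ ↔ σ = 1 := by
  refine ⟨fun h => ?_, fun h => h ▸ .zero⟩
  generalize ht : 0 = t at h
  cases h with
  | zero => rfl
  | succ => omega

theorem exists_of_succ {t : ℕ} {ρ : Perm V} (h : Routable G (t + 1) ρ) :
    ∃ τ σ : Perm V, IsStep G τ ∧ Routable G t σ ∧ ρ = τ * σ := by
  generalize ht : t + 1 = s at h
  cases h with
  | zero => omega
  | succ h h' =>
    obtain rfl := Nat.succ_injective ht
    exact ⟨_, _, h, h', rfl⟩

theorem of_step {τ : Perm V} (h : IsStep G τ) : Routable G 1 τ := by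
  simpa using Routable.succ h Routable.zero

theorem one (t : ℕ) : Routable G t 1 := by
  induction t with
  | zero => exact .zero
  | succ t ih => simpa using Routable.succ (isStep_one G) ih

theorem mul {s t : ℕ} {σ τ : Perm V} (hσ : Routable G s σ) (hτ : Routable G t τ) :
    Routable G (s + t) (σ * τ) := by
  induction hσ with
  | zero => simpa using hτ
  | succ h _ ih =>
    rw [mul_assoc, Nat.add_right_comm]
    exact .succ h ih

theorem mono {s t : ℕ} {σ : Perm V} (hσ : Routable G s σ) (h : s ≤ t) : Routable G t σ := by
  obtain ⟨d, rfl⟩ := Nat.exists_eq_add_of_le h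
  simpa using hσ.mul (Routable.one (G := G) d)

theorem inv {t : ℕ} {σ : Perm V} (hσ : Routable G t σ) : Routable G t σ⁻¹ := by
  induction hσ with
  | zero => simpa using Routable.zero
  | succ h _ ih =>
    rw [mul_inv_rev, h.inv_eq]
    exact ih.mul (of_step h)

theorem viaEmbedding {G' : SimpleGraph V'} (ι : V ↪ V')
    (hG : ∀ u v, G.Adj u v → G'.Adj (ι u) (ι v)) {t : ℕ} {σ : Perm V} (hσ : Routable G t σ) :
    Routable G' t (σ.viaEmbedding ι) := by
  induction hσ with
  | zero =>
    have : (1 : Perm V).viaEmbedding ι = 1 := map_one (Perm.viaEmbeddingHom ι)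
    rw [this]
    exact .zero
  | @succ t τ σ h _ ih =>
    have : (τ * σ).viaEmbedding ι = τ.viaEmbedding ι * σ.viaEmbedding ι :=
      map_mul (Perm.viaEmbeddingHom ι) τ σ
    rw [this]
    refine .succ (fun v => ?_) ih
    by_cases hv : v ∈ Set.range ι
    · obtain ⟨u, rfl⟩ := hv
      simp only [Perm.viaEmbedding_apply, (h u).1, true_and]
      exact (h u).2.imp (congrArg ι) (hG _ _)
    · simp [Perm.viaEmbedding_apply_of_notMem _ ι v hv]

theorem of_le {G' : SimpleGraph V} (hG : G ≤ G') {t : ℕ} {σ : Perm V} (hσ : Routable G t σ) :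
    Routable G' t σ := by
  induction hσ with
  | zero => exact .zero
  | succ h _ ih => exact .succ (fun v => ⟨(h v).1, (h v).2.imp_right fun a => hG a⟩) ih

/-- Permutations of the parts of a disjoint union are routed in parallel. -/
theorem sigmaCongrRight {α : Type*} {β : α → Type*} {G : SimpleGraph (Σ a, β a)}
    {H : ∀ a, SimpleGraph (β a)}
    (hG : ∀ a b b', (H a).Adj b b' → G.Adj ⟨a, b⟩ ⟨a, b'⟩) {t : ℕ} {F : ∀ a, Perm (β a)}
    (hF : ∀ a, Routable (H a) t (F a)) : Routable G t (Perm.sigmaCongrRight F) := by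
  induction t generalizing F with
  | zero =>
    have : F = 1 := funext fun a => zero_iff.1 (hF a)
    rw [this]
    have : Perm.sigmaCongrRight (1 : ∀ a, Perm (β a)) = 1 :=
      map_one (Perm.sigmaCongrRightHom β)
    rw [this]
    exact .zero
  | succ t ih =>
    have := fun a => exists_of_succ (hF a)
    choose τ σ hτ hσ hF using this
    have : F = τ * σ := funext hF
    rw [this]
    have : Perm.sigmaCongrRight (τ * σ) = Perm.sigmaCongrRight τ * Perm.sigmaCongrRight σ :=
      map_mul (Perm.sigmaCongrRightHom β) τ σ
    rw [this]
    refine .succ ?_ (ih hσ)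
    rintro ⟨a, b⟩
    have h1 := (hτ a b).1
    have h2 := (hτ a b).2
    constructor
    · simp [h1]
    · refine h2.imp (fun h => ?_) (fun h => hG _ _ _ h)
      simp [h]

end Routable

/-- `x` and `y` are exchanged by one of the steps while they are moved by all of them. -/
def Meet : List (Perm V) → V → V → Prop
  | [], _, _ => False
  | M :: Ms, x, y => M x = y ∨ Meet Ms (M x) (M y)

/-- The vertices that something starting at `x` is at before each of the steps. -/
def Visits : List (Perm V) → V → V → Prop
  | [], _, _ => False
  | M :: Ms, x, y => x = y ∨ Visits Ms (M x) y

/-- The joint effect of the steps, the head of the list being the first one. -/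
def netEffect : List (Perm V) → Perm V
  | [] => 1
  | M :: Ms => netEffect Ms * M

theorem routable_netEffect {G : SimpleGraph V} {Ms : List (Perm V)}
    (h : ∀ M ∈ Ms, IsStep G M) : Routable G Ms.length (netEffect Ms) := by
  induction Ms with
  | nil => exact .zero
  | cons M Ms ih =>
    exact (ih fun N hN => h N (List.mem_cons_of_mem _ hN)).mul (.of_step (h M List.mem_cons_self))

/-- Leaving out the swaps at which `x` and `τ x` meet has the effect of applying the involution `τ`
beforehand. -/
theorem routable_netEffect_mul {G : SimpleGraph V} {Ms : List (Perm V)}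
    (h : ∀ M ∈ Ms, IsStep G M) {τ : Perm V} (hτ : ∀ x, τ (τ x) = x)
    (hm : ∀ x, τ x = x ∨ Meet Ms x (τ x)) : Routable G Ms.length (netEffect Ms * τ) := by
  classical
  induction Ms generalizing τ with
  | nil =>
    have : τ = 1 := Equiv.ext fun x => by simpa [Meet] using hm x
    rw [this]
    exact .zero
  | cons M Ms ih =>
    have hM := h M List.mem_cons_self
    let f : V → V := fun x => if M x = τ x then x else M x
    have hf : Function.Involutive f := by
      intro x
      by_cases hx : M x = τ x
      · simp [f, hx]
      · have : ¬ M (M x) = τ (M x) := by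
          rw [(hM x).1]
          intro h'
          apply hx
          rw [h', hτ, ← h']
        simp only [f, if_neg hx, if_neg this]
        exact (hM x).1
    let M' : Perm V := hf.toPerm
    have hM' : ∀ x, M' x = if M x = τ x then x else M x := fun x => rfl
    have hstep : IsStep G M' := by
      intro x
      refine ⟨hf x, ?_⟩
      rw [hM']
      split_ifs
      · exact Or.inl rfl
      · exact (hM x).2
    -- What the remaining steps still have to realise, expressed at the positions after the
    -- thinned-out step `M'`.
    let τ' : Perm V := M * τ * M'
    have key : ∀ x, τ' (M' x) = M (τ x) := fun x => by
      change M (τ (M' (M' x))) = _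
      rw [show M' (M' x) = x from hf x]
    have hprod : netEffect (M :: Ms) * τ = netEffect Ms * τ' * M' := by
      ext x
      change netEffect Ms (M (τ x)) = netEffect Ms (τ' (M' x))
      rw [key]
    rw [hprod]
    -- A pair that meets now has its swap left out and is thereby settled for good.
    have hfix : ∀ x, M x = τ x → τ' x = x := by
      intro x hx
      have := key x
      rw [hM', if_pos hx, ← hx, (hM x).1] at this
      exact this
    refine (ih (fun N hN => h N (List.mem_cons_of_mem _ hN)) (τ := τ') ?_ ?_).mul (.of_step hstep)
    · intro y
      obtain ⟨x, rfl⟩ := M'.surjective y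
      by_cases hx : M x = τ x
      · rw [hM', if_pos hx, hfix x hx, hfix x hx]
      · have h2 : ¬ M (τ x) = τ (τ x) := by
          rw [hτ]
          intro h'
          apply hx
          rw [← h', (hM _).1, h']
        rw [key]
        have := key (τ x)
        rw [hM', if_neg h2, hτ] at this
        rw [this, hM', if_neg hx]
    · intro y
      obtain ⟨x, rfl⟩ := M'.surjective y
      by_cases hx : M x = τ x
      · left
        rw [hM', if_pos hx, hfix x hx]
      · rw [key, hM', if_neg hx]
        rcases hm x with h' | h' | h'
        · left; rw [h']
        · exact absurd h' hx
        · exact Or.inr h'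

/-- Every permutation is a product of two involutions. -/
theorem exists_involutions_mul_eq (σ : Perm V) :
    ∃ τ τ' : Perm V, (∀ x, τ (τ x) = x) ∧ (∀ x, τ' (τ' x) = x) ∧ σ = τ * τ' := by
  classical
  let s : Setoid V := Perm.SameCycle.setoid σ
  let r : V → V := fun x => (Quotient.mk s x).out
  have hr : ∀ x, ∃ j : ℤ, (σ ^ j) (r x) = x := fun x => Quotient.mk_out (s := s) x
  have hrc : ∀ x (j : ℤ), r ((σ ^ j) (r x)) = r x := by
    intro x j
    have h1 : Quotient.mk s ((σ ^ j) (r x)) = Quotient.mk s x := by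
      refine Quotient.sound ?_
      have h2 : σ.SameCycle (r x) x := hr x
      exact (Perm.sameCycle_zpow_left (n := j)).2 h2
    simp only [r, h1]
  choose j hj using hr
  -- The reflection of every cycle about its representative. Both `f` and `σ * f` are reflections,
  -- hence involutions; `hf` shows that the choice of the exponents does not matter.
  let f : V → V := fun x => (σ ^ (-j x)) (r x)
  have hf : ∀ x (i : ℤ), f ((σ ^ i) (r x)) = (σ ^ (-i)) (r x) := by
    intro x i
    have h1 := hj ((σ ^ i) (r x))
    rw [hrc] at h1
    simp only [f, hrc]
    rw [zpow_neg, zpow_neg, Perm.inv_eq_iff_eq]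
    rw [← Perm.mul_apply, ← zpow_neg, ← zpow_add, add_comm, zpow_add, Perm.mul_apply] 
    rw [zpow_neg, eq_comm, ← Perm.eq_inv_iff_eq, inv_inv]
    rw [h1]
  have hinv : Function.Involutive f := by
    intro x
    have := hf x (j x)
    rw [hj] at this
    rw [this, hf, neg_neg, hj]
  refine ⟨σ * hinv.toPerm, hinv.toPerm, ?_, hinv, ?_⟩
  · intro x
    change σ (f (σ (f x))) = x
    have h1 : f x = (σ ^ (-j x)) (r x) := rfl
    have h2 : σ (f x) = (σ ^ (1 - j x)) (r x) := by
      rw [h1, ← Perm.mul_apply, ← zpow_one_add, sub_eq_add_neg]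
    rw [h2, hf, ← Perm.mul_apply, ← zpow_one_add]
    have : (1 + -(1 - j x)) = j x := by ring
    rw [this, hj]
  · ext x
    change σ x = σ (f (f x))
    rw [hinv]

end QRouting

/-! ### Routing on a path by odd-even transposition. -/

namespace QRouting

open Equiv SimpleGraph

/-- The position at time `z` of a token that travels back and forth on a path of `m` vertices. -/
def fold (m z : ℕ) : ℕ := if z % (2 * m) < m then z % (2 * m) else 2 * m - 1 - z % (2 * m)

theorem fold_lt {m : ℕ} (hm : 0 < m) (z : ℕ) : fold m z < m := by
  have := Nat.mod_lt z (show 0 < 2 * m by omega)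
  unfold fold
  split_ifs <;> omega

theorem succ_mod_two_mul {m : ℕ} (hm : 0 < m) (z : ℕ) :
    (z + 1) % (2 * m) = if z % (2 * m) + 1 = 2 * m then 0 else z % (2 * m) + 1 := by
  have := Nat.mod_lt z (show 0 < 2 * m by omega)
  rw [Nat.add_mod]
  split_ifs with h
  · rw [Nat.mod_eq_of_lt (show 1 < 2 * m by omega), h, Nat.mod_self]
  · rw [Nat.mod_eq_of_lt (show 1 < 2 * m by omega), Nat.mod_eq_of_lt (by omega)]

/-- Modulo the period `2 * m`, the clock values `z` and `-1 - z` are the ascending and the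
descending visit to the same position. -/
theorem fold_eq_of_add {m a z z' : ℕ} (hm : 0 < m) (h : z + z' + 1 = 2 * m * a) :
    fold m z = fold m z' := by
  have hz := Nat.mod_lt z (show 0 < 2 * m by omega)
  have hz' := Nat.mod_lt z' (show 0 < 2 * m by omega)
  have h0 : (z % (2 * m) + z' % (2 * m) + 1) % (2 * m) = 0 := by
    have : (z + z' + 1) % (2 * m) = 0 := by rw [h, Nat.mul_mod_right]
    rw [← this]
    simp [Nat.add_mod]
  have : z % (2 * m) + z' % (2 * m) + 1 = 2 * m := by
    obtain ⟨c, hc⟩ := Nat.dvd_of_mod_eq_zero h0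
    have h1 : c < 2 := by
      by_contra hc2
      have : 2 * m * 2 ≤ 2 * m * c := Nat.mul_le_mul_left _ (by omega)
      omega
    have h2 : c ≠ 0 := by rintro rfl; omega
    obtain rfl : c = 1 := by omega
    omega
  unfold fold
  split_ifs <;> omega

/-- Position `i` at time `t` in the brick pattern is exchanged with this position. -/
def brickFun (m t i : ℕ) : ℕ :=
  if (i + t) % 2 = 0 then (if i + 1 < m then i + 1 else i) else i - 1

/-- When the clock `z` has the parity of `t`, the position has that parity on the way up and the
opposite one on the way down, so the brick pattern pushes the token along its course; at either end
it rests for one step. -/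
theorem brickFun_fold {m t z : ℕ} (hm : 0 < m) (hz : z % 2 = t % 2) :
    brickFun m t (fold m z) = fold m (z + 1) := by
  have h := Nat.mod_lt z (show 0 < 2 * m by omega)
  have h1 := succ_mod_two_mul hm z
  have h2 : z % (2 * m) % 2 = z % 2 := Nat.mod_mod_of_dvd _ ⟨m, rfl⟩
  unfold brickFun fold
  rw [h1]
  split_ifs <;> omega

theorem brickFun_brickFun {m t i : ℕ} (hi : i < m) : brickFun m t (brickFun m t i) = i := by
  unfold brickFun
  split_ifs <;> omega

theorem brickFun_lt {m t i : ℕ} (hi : i < m) : brickFun m t i < m := by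
  unfold brickFun
  split_ifs <;> omega

/-- The swaps of odd-even transposition sort at time `t`. -/
def brick (m t : ℕ) : Perm (Fin m) :=
  Function.Involutive.toPerm (fun i => ⟨brickFun m t i, brickFun_lt i.2⟩)
    fun i => Fin.ext (brickFun_brickFun i.2)

theorem brick_val (m t : ℕ) (i : Fin m) : (brick m t i : ℕ) = brickFun m t i := rfl

theorem isStep_brick (m t : ℕ) : IsStep (pathGraph m) (brick m t) := by
  intro i
  refine ⟨Fin.ext (brickFun_brickFun i.2), ?_⟩
  rw [pathGraph_adj, Fin.ext_iff, brick_val]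
  unfold brickFun
  split_ifs <;> omega

/-- `s` consecutive steps of odd-even transposition, starting at time `t`. -/
def bricks (m : ℕ) : ℕ → ℕ → List (Perm (Fin m))
  | 0, _ => []
  | s + 1, t => brick m t :: bricks m s (t + 1)

theorem length_bricks (m s t : ℕ) : (bricks m s t).length = s := by
  induction s generalizing t with
  | zero => rfl
  | succ s ih => simp [bricks, ih]

theorem isStep_of_mem_bricks {m s t : ℕ} : ∀ M ∈ bricks m s t, IsStep (pathGraph m) M := by
  induction s generalizing t with
  | zero => simp [bricks]
  | succ s ih =>
    intro M hM
    rcases List.mem_cons.1 hM with rfl | hM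
    · exact isStep_brick m t
    · exact ih M hM

/-- `fold` as a vertex of the path. -/
def foldFin {m : ℕ} (hm : 0 < m) (z : ℕ) : Fin m := ⟨fold m z, fold_lt hm z⟩

theorem brick_foldFin {m t z : ℕ} (hm : 0 < m) (hz : z % 2 = t % 2) :
    brick m t (foldFin hm z) = foldFin hm (z + 1) :=
  Fin.ext (brickFun_fold hm hz)

theorem meet_bricks {m : ℕ} (hm : 0 < m) {s t z z' i : ℕ} (hz : z % 2 = t % 2)
    (hz' : z' % 2 = t % 2) (hi : i < s) (h : fold m (z + i + 1) = fold m (z' + i)) :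
    Meet (bricks m s t) (foldFin hm z) (foldFin hm z') := by
  induction s generalizing t z z' i with
  | zero => omega
  | succ s ih =>
    change _ ∨ _
    rw [brick_foldFin hm hz, brick_foldFin hm hz']
    cases i with
    | zero => exact Or.inl (Fin.ext h)
    | succ i =>
      refine Or.inr (ih (i := i) (by omega) (by omega) (by omega) ?_)
      rw [← show z + (i + 1) + 1 = z + 1 + i + 1 by omega, h]
      congr 1
      omega

theorem visits_bricks {m : ℕ} (hm : 0 < m) {s t z i : ℕ} (hz : z % 2 = t % 2) (hi : i < s) :
    Visits (bricks m s t) (foldFin hm z) (foldFin hm (z + i)) := by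
  induction s generalizing t z i with
  | zero => omega
  | succ s ih =>
    change _ ∨ _
    rw [brick_foldFin hm hz]
    cases i with
    | zero => exact Or.inl rfl
    | succ i =>
      refine Or.inr ?_
      rw [← show z + 1 + i = z + (i + 1) by omega]
      exact ih (by omega) (by omega)

/-- At time 0 the clock must be even: a token at an even position starts on its way up, one at an
odd position on its way down. -/
theorem exists_foldFin_eq {m : ℕ} (i : Fin m) :
    ∃ a, a < m ∧ foldFin (Fin.pos i) (2 * a) = i := by
  have hi := i.2
  obtain ⟨a, ha, h⟩ : ∃ a, a < m ∧ (2 * a = (i : ℕ) ∨ 2 * a = 2 * m - 1 - i) := by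
    rcases Nat.even_or_odd' (i : ℕ) with ⟨c, hc | hc⟩
    · exact ⟨c, by omega, by omega⟩
    · exact ⟨m - 1 - c, by omega, by omega⟩
  refine ⟨a, ha, Fin.ext ?_⟩
  change fold m (2 * a) = i
  have h2 : 2 * a % (2 * m) = 2 * a := Nat.mod_eq_of_lt (by omega)
  unfold fold
  rw [h2]
  split_ifs <;> omega

theorem meet_bricks_self {m : ℕ} (i j : Fin m) : Meet (bricks m m 0) i j := by
  have hm := Fin.pos i
  obtain ⟨a, ha, hi⟩ := exists_foldFin_eq i
  obtain ⟨b, hb, hj⟩ := exists_foldFin_eq j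
  rw [← hi, ← hj]
  have hlt := Nat.mod_lt (a + b) hm
  -- The clocks `2 * a + i + 1` and `2 * b + i` are mirror images when `m` divides `a + b + i + 1`,
  -- which some `i < m` achieves.
  refine meet_bricks hm (i := m - 1 - (a + b) % m) (by omega) (by omega) (by omega) ?_
  refine fold_eq_of_add (a := (a + b) / m + 1) hm ?_
  have h1 := Nat.div_add_mod (a + b) m
  have h2 : 2 * m * ((a + b) / m + 1) = 2 * (m * ((a + b) / m)) + 2 * m := by ring
  omega

/-- In `2 * m` steps the clock runs through a full period. -/
theorem visits_bricks_two_mul {m : ℕ} (i j : Fin m) : Visits (bricks m (2 * m) 0) i j := by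
  have hm := Fin.pos i
  obtain ⟨a, ha, hi⟩ := exists_foldFin_eq i
  obtain ⟨b, hb, hj⟩ := exists_foldFin_eq j
  have key : ∀ s, s < 2 * m → foldFin hm (2 * a + s) = j → Visits (bricks m (2 * m) 0) i j := by
    rintro s hs rfl
    rw [← hi]
    exact visits_bricks hm (by omega) hs
  rcases le_or_gt a b with h | h
  · refine key (2 * b - 2 * a) (by omega) ?_
    rw [← hj]
    congr 1
    omega
  · refine key (2 * b + 2 * m - 2 * a) (by omega) ?_
    rw [← hj, show 2 * a + (2 * b + 2 * m - 2 * a) = 2 * b + 2 * m by omega]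
    refine Fin.ext ?_
    change fold m _ = fold m _
    simp [fold]

/-- All pairs meet within `m` rounds, so for an involution `τ` the thinned-out rounds yield the net
effect times `τ`. Undoing the net effect costs another `m` steps, and two involutions suffice. -/
theorem routable_pathGraph {m : ℕ} (σ : Perm (Fin m)) : Routable (pathGraph m) (4 * m) σ := by
  have key : ∀ τ : Perm (Fin m), (∀ x, τ (τ x) = x) → Routable (pathGraph m) (2 * m) τ := by
    intro τ hτ
    have h1 := (routable_netEffect (isStep_of_mem_bricks (m := m) (s := m) (t := 0))).inv
    have h2 := routable_netEffect_mul (isStep_of_mem_bricks (m := m) (s := m) (t := 0)) hτ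
      fun x => Or.inr (meet_bricks_self _ _)
    have h := h1.mul h2
    rw [inv_mul_cancel_left, length_bricks, ← two_mul] at h
    exact h
  obtain ⟨τ, τ', hτ, hτ', rfl⟩ := exists_involutions_mul_eq σ
  exact ((key τ hτ).mul (key τ' hτ')).mono (by omega)

end QRouting

/-! ### Edge colourings of regular bipartite multigraphs. -/

namespace QRouting

open Equiv SimpleGraph Finset

theorem card_filter_mem {X W : Type*} [DecidableEq W] {S : Finset X} {k : ℕ} (h : X → W)
    (hh : ∀ x ∈ S, #{x' ∈ S | h x' = h x} = k) (A : Finset W) (hA : A ⊆ S.image h) :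
    #{x ∈ S | h x ∈ A} = #A * k := by
  rw [Finset.card_eq_sum_card_fiberwise (s := {x ∈ S | h x ∈ A}) (f := h) (t := A)
    (fun x hx => (mem_filter.1 (mem_coe.1 hx)).2)]
  refine Finset.sum_const_nat fun w hw => ?_
  obtain ⟨x, hx, rfl⟩ := mem_image.1 (hA hw)
  rw [← hh x hx, filter_filter]
  congr 1
  refine filter_congr fun x' _ => ⟨fun h => h.2, fun h => ⟨h ▸ hw, h⟩⟩

theorem card_filter_sdiff {X W : Type*} [DecidableEq X] [DecidableEq W] {S T : Finset X} {k : ℕ}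
    (hTS : T ⊆ S) (h : X → W) (h1 : ∀ x ∈ S, #{x' ∈ S | h x' = h x} = k + 1)
    (h2 : ∀ x ∈ S, #{x' ∈ T | h x' = h x} = 1) :
    ∀ x ∈ S \ T, #{x' ∈ S \ T | h x' = h x} = k := by
  intro x hx
  have hx := (mem_sdiff.1 hx).1
  have : ({x' ∈ S \ T | h x' = h x} : Finset X) =
      {x' ∈ S | h x' = h x} \ {x' ∈ T | h x' = h x} := by
    ext y
    simp only [mem_filter, mem_sdiff]
    tauto
  rw [this, card_sdiff_of_subset (filter_subset_filter _ hTS), h1 x hx, h2 x hx]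
  rfl

theorem eq_of_extend_coloring {X W : Type*} [DecidableEq X] [DecidableEq W] {S T : Finset X}
    {k : ℕ} {c : X → ℕ} (hc : ∀ x ∈ S \ T, c x < k) (h : X → W)
    (h1 : ∀ x ∈ S, #{x' ∈ T | h x' = h x} = 1)
    (h2 : ∀ x ∈ S \ T, ∀ x' ∈ S \ T, c x = c x' → h x = h x' → x = x') :
    ∀ x ∈ S, ∀ x' ∈ S, (if x ∈ T then k else c x) = (if x' ∈ T then k else c x') →
      h x = h x' → x = x' := by
  intro x hx x' hx' hxx hh
  by_cases hT : x ∈ T <;> by_cases hT' : x' ∈ T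
  · obtain ⟨a, ha⟩ := card_eq_one.1 (h1 x hx)
    have e1 : x ∈ ({a} : Finset X) := ha ▸ mem_filter.2 ⟨hT, rfl⟩
    have e2 : x' ∈ ({a} : Finset X) := ha ▸ mem_filter.2 ⟨hT', hh.symm⟩
    rw [mem_singleton.1 e1, mem_singleton.1 e2]
  · rw [if_pos hT, if_neg hT'] at hxx
    exact absurd hxx (hc x' (mem_sdiff.2 ⟨hx', hT'⟩)).ne'
  · rw [if_neg hT, if_pos hT'] at hxx
    exact absurd hxx (hc x (mem_sdiff.2 ⟨hx, hT⟩)).ne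
  · rw [if_neg hT, if_neg hT'] at hxx
    exact h2 x (mem_sdiff.2 ⟨hx, hT⟩) x' (mem_sdiff.2 ⟨hx', hT'⟩) hxx hh

/-- A regular bipartite multigraph, given by the ends `f x` and `g x` of its edges `x ∈ S`, contains
a perfect matching. -/
theorem exists_perfect_matching {X Y Z : Type*} [DecidableEq X] [DecidableEq Y] [DecidableEq Z]
    (f : X → Y) (g : X → Z) (k : ℕ) (S : Finset X)
    (hf : ∀ x ∈ S, #{x' ∈ S | f x' = f x} = k + 1)
    (hg : ∀ x ∈ S, #{x' ∈ S | g x' = g x} = k + 1) :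
    ∃ T ⊆ S, (∀ x ∈ S, #{x' ∈ T | f x' = f x} = 1) ∧ ∀ x ∈ S, #{x' ∈ T | g x' = g x} = 1 := by
  let t : S.image f → Finset Z := fun y => {x ∈ S | f x = y}.image g
  -- Hall's condition by double counting: the `#A * (k + 1)` edges at `A` all end among the
  -- neighbours of `A`, each of which carries only `k + 1` edges.
  have hall : ∀ A : Finset (S.image f), #A ≤ #(A.biUnion t) := by
    intro A
    have h1 := card_filter_mem f hf (A.map (Function.Embedding.subtype _)) (by
      intro y hy
      obtain ⟨y', _, rfl⟩ := Finset.mem_map.1 hy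
      exact y'.2)
    have h2 := card_filter_mem g hg (A.biUnion t) (by
      intro z hz
      obtain ⟨y, _, hz⟩ := mem_biUnion.1 hz
      obtain ⟨x, hx, rfl⟩ := mem_image.1 (show z ∈ image g _ from hz)
      exact mem_image_of_mem _ (mem_filter.1 hx).1)
    have h3 : #{x ∈ S | f x ∈ A.map (Function.Embedding.subtype _)} ≤
        #{x ∈ S | g x ∈ A.biUnion t} := by
      refine card_le_card fun x hx => ?_
      obtain ⟨hx, hxA⟩ := mem_filter.1 hx
      obtain ⟨y, hy, hyx⟩ := Finset.mem_map.1 hxA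
      exact mem_filter.2 ⟨hx, mem_biUnion.2 ⟨y, hy, mem_image_of_mem _
        (mem_filter.2 ⟨hx, hyx.symm⟩)⟩⟩
    rw [h1, h2, card_map] at h3
    exact Nat.le_of_mul_le_mul_right h3 (Nat.succ_pos k)
  obtain ⟨φ, hφ, hφt⟩ := (Finset.all_card_le_biUnion_card_iff_exists_injective t).1 hall
  have hex : ∀ y : S.image f, ∃ x ∈ S, f x = y ∧ g x = φ y := by
    intro y
    obtain ⟨x, hx, hxy⟩ := mem_image.1 (hφt y)
    exact ⟨x, (mem_filter.1 hx).1, (mem_filter.1 hx).2, hxy⟩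
  choose e heS hef heg using hex
  -- Regularity makes both sides equally large, so the matching also covers the second side.
  have hfib : ∀ z ∈ S.image g, ∃ y, φ y = z := by
    have h1 := card_filter_mem f hf _ subset_rfl
    have h2 := card_filter_mem g hg _ subset_rfl
    have h3 : #(S.image f) = #(S.image g) := by
      refine Nat.eq_of_mul_eq_mul_right (Nat.succ_pos k) ?_
      rw [← h1, ← h2, filter_true_of_mem fun x hx => mem_image_of_mem _ hx,
        filter_true_of_mem fun x hx => mem_image_of_mem _ hx]
    have h4 : univ.image φ = S.image g := by
      refine eq_of_subset_of_card_le (fun z hz => ?_) ?_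
      · obtain ⟨y, _, rfl⟩ := mem_image.1 hz
        rw [← heg]
        exact mem_image_of_mem _ (heS y)
      · rw [card_image_of_injective _ hφ, card_univ, Fintype.card_coe, h3]
    intro z hz
    rw [← h4] at hz
    obtain ⟨y, _, hy⟩ := mem_image.1 hz
    exact ⟨y, hy⟩
  refine ⟨univ.image e, fun x hx => ?_, fun x hx => ?_, fun x hx => ?_⟩
  · obtain ⟨y, _, rfl⟩ := mem_image.1 hx
    exact heS y
  · rw [card_eq_one]
    refine ⟨e ⟨f x, mem_image_of_mem _ hx⟩, ?_⟩
    ext x'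
    rw [mem_filter, mem_singleton, mem_image]
    constructor
    · rintro ⟨⟨y, _, rfl⟩, hy⟩
      congr 1
      rw [hef] at hy
      exact Subtype.ext hy
    · rintro rfl
      exact ⟨⟨_, mem_univ _, rfl⟩, hef _⟩
  · obtain ⟨y, hy⟩ := hfib (g x) (mem_image_of_mem _ hx)
    rw [card_eq_one]
    refine ⟨e y, ?_⟩
    ext x'
    rw [mem_filter, mem_singleton, mem_image]
    constructor
    · rintro ⟨⟨y', _, rfl⟩, hy'⟩
      rw [heg, ← hy] at hy'
      rw [hφ hy']
    · rintro rfl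
      exact ⟨⟨_, mem_univ _, rfl⟩, by rw [heg, hy]⟩

/-- König's edge colouring theorem for regular bipartite multigraphs. -/
theorem exists_edge_coloring {X Y Z : Type*} [DecidableEq X] [DecidableEq Y] [DecidableEq Z]
    (f : X → Y) (g : X → Z) (k : ℕ) (S : Finset X)
    (hf : ∀ x ∈ S, #{x' ∈ S | f x' = f x} = k) (hg : ∀ x ∈ S, #{x' ∈ S | g x' = g x} = k) :
    ∃ c : X → ℕ, (∀ x ∈ S, c x < k) ∧
      (∀ x ∈ S, ∀ x' ∈ S, c x = c x' → f x = f x' → x = x') ∧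
      (∀ x ∈ S, ∀ x' ∈ S, c x = c x' → g x = g x' → x = x') := by
  induction k generalizing S with
  | zero =>
    have : ∀ x, x ∉ S := fun x hx => by
      have h : x ∈ ({x' ∈ S | f x' = f x} : Finset X) := mem_filter.2 ⟨hx, rfl⟩
      rw [card_eq_zero.1 (hf x hx)] at h
      exact notMem_empty x h
    exact ⟨fun _ => 0, fun x hx => absurd hx (this x), fun x hx => absurd hx (this x),
      fun x hx => absurd hx (this x)⟩
  | succ k ih =>
    obtain ⟨T, hTS, hTf, hTg⟩ := exists_perfect_matching f g k S hf hg
    obtain ⟨c, hc, hcf, hcg⟩ := ih (S \ T) (card_filter_sdiff hTS f hf hTf) (card_filter_sdiff hTS g hg hTg)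
    refine ⟨fun x => if x ∈ T then k else c x, fun x hx => ?_,
      eq_of_extend_coloring hc f hTf hcf, eq_of_extend_coloring hc g hTg hcg⟩
    dsimp only
    split_ifs with hT
    · exact Nat.lt_succ_self k
    · exact (hc x (mem_sdiff.2 ⟨hx, hT⟩)).trans (Nat.lt_succ_self k)

/-- Two fixed-point-free involutions of a finite set have a common 2-colouring. -/
theorem exists_two_coloring {X : Type*} [Fintype X] [DecidableEq X] {ρ ρ' : X → X}
    (h1 : ∀ x, ρ (ρ x) = x) (h2 : ∀ x, ρ x ≠ x) (h1' : ∀ x, ρ' (ρ' x) = x)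
    (h2' : ∀ x, ρ' x ≠ x) : ∃ c : X → Bool, (∀ x, c (ρ x) ≠ c x) ∧ ∀ x, c (ρ' x) ≠ c x := by
  have fiber : ∀ {ρ : X → X}, (∀ x, ρ (ρ x) = x) → (∀ x, ρ x ≠ x) → ∀ x ∈ (univ : Finset X),
      #{x' ∈ univ | ({x', ρ x'} : Finset X) = {x, ρ x}} = 2 := by
    intro ρ h1 h2 x _
    rw [← card_pair (h2 x).symm]
    congr 1
    ext y
    rw [mem_filter, mem_insert, mem_singleton]
    constructor
    · rintro ⟨_, h⟩
      have : y ∈ ({x, ρ x} : Finset X) := h ▸ mem_insert_self y _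
      simpa using this
    · rintro (rfl | rfl)
      · exact ⟨mem_univ _, rfl⟩
      · exact ⟨mem_univ _, by rw [h1, pair_comm]⟩
  -- Each point is an edge joining its orbit under `ρ` to its orbit under `ρ'`. Orbits have two
  -- points, so the multigraph is 2-regular.
  obtain ⟨c, hc, hcf, hcg⟩ := exists_edge_coloring (fun x => ({x, ρ x} : Finset X))
    (fun x => ({x, ρ' x} : Finset X)) 2 univ (fiber h1 h2) (fiber h1' h2')
  refine ⟨fun x => decide (c x = 0), fun x h => ?_, fun x h => ?_⟩
  · have e1 := hc x (mem_univ _)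
    have e2 := hc (ρ x) (mem_univ _)
    have e3 : c (ρ x) = 0 ↔ c x = 0 := decide_eq_decide.1 h
    refine h2 x (hcf _ (mem_univ _) _ (mem_univ _) (by omega) ?_)
    rw [h1, pair_comm]
  · have e1 := hc x (mem_univ _)
    have e2 := hc (ρ' x) (mem_univ _)
    have e3 : c (ρ' x) = 0 ↔ c x = 0 := decide_eq_decide.1 h
    refine h2' x (hcg _ (mem_univ _) _ (mem_univ _) (by omega) ?_)
    rw [h1', pair_comm]

/-! ### Routing on the cube-connected paths. -/

/-- The vertices of the cube-connected paths: a column of `k` levels for every vertex of the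
`k`-dimensional cube. -/
abbrev Core (k : ℕ) : Type := Σ _ : Fin k → Bool, Fin k

namespace Core

variable {k : ℕ}

/-- The vertex on the same level in the column across the dimension of the level. -/
def cross (x : Core k) : Core k := ⟨Function.update x.1 x.2 (!x.1 x.2), x.2⟩

theorem cross_cross (x : Core k) : cross (cross x) = x := by
  simp [cross]

theorem cross_ne (x : Core k) : cross x ≠ x := by
  intro h
  have := congrArg (fun y : Core k => y.1 x.2) h
  simp [cross] at this

/-- The cube-connected paths. -/
def graph (k : ℕ) : SimpleGraph (Core k) where
  Adj x y := (x.1 = y.1 ∧ (pathGraph k).Adj x.2 y.2) ∨ y = cross x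
  symm := ⟨by
    rintro x y (⟨h, h'⟩ | rfl)
    · exact Or.inl ⟨h.symm, h'.symm⟩
    · exact Or.inr (cross_cross x).symm⟩
  loopless := ⟨fun x h => h.elim (fun h => h.2.ne rfl) fun h => cross_ne x h.symm⟩

/-- Sets the coordinate that belongs to the level as the colouring tells. -/
def switchFun (c : Core k → Bool) (x : Core k) : Core k :=
  if x.1 x.2 = c x then x else cross x

theorem switchFun_snd (c : Core k → Bool) (x : Core k) : (switchFun c x).2 = x.2 := by
  unfold switchFun
  split_ifs <;> rfl

theorem switchFun_fst_self (c : Core k → Bool) (x : Core k) :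
    (switchFun c x).1 x.2 = c x := by
  unfold switchFun
  split_ifs with h
  · exact h
  · simpa [cross] using (Bool.eq_not.2 (Ne.symm h)).symm

theorem switchFun_fst_of_ne (c : Core k → Bool) (x : Core k) {d : Fin k} (hd : d ≠ x.2) :
    (switchFun c x).1 d = x.1 d := by
  unfold switchFun
  split_ifs
  · rfl
  · simp [cross, Function.update_of_ne hd]

/-- The ends of a cross edge have opposite coordinates and want opposite values, so either both stay
or they change places. -/
theorem switchFun_involutive {c : Core k → Bool} (hc : ∀ x, c (cross x) ≠ c x) :
    Function.Involutive (switchFun c) := by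
  intro x
  by_cases h : x.1 x.2 = c x
  · simp [switchFun, h]
  · have h1 := hc x
    have h2 : ¬ (cross x).1 (cross x).2 = c (cross x) := by
      rw [Bool.eq_not.2 h1, show (cross x).1 (cross x).2 = !x.1 x.2 by simp [cross]]
      exact fun h' => h (Bool.not_inj h')
    rw [switchFun, if_neg (by rw [switchFun, if_neg h]; exact h2), switchFun, if_neg h, cross_cross]

theorem isStep_switch {c : Core k → Bool} (hc : ∀ x, c (cross x) ≠ c x) :
    IsStep (graph k) (switchFun_involutive hc).toPerm := by
  intro x
  refine ⟨switchFun_involutive hc x, ?_⟩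
  change switchFun c x = x ∨ _ ∨ switchFun c x = _
  unfold switchFun
  split_ifs
  · exact Or.inl rfl
  · exact Or.inr (Or.inr rfl)

theorem routable_columns {t : ℕ} {F : (Fin k → Bool) → Perm (Fin k)}
    (hF : ∀ w, Routable (pathGraph k) t (F w)) : Routable (graph k) t (Perm.sigmaCongrRight F) :=
  Routable.sigmaCongrRight (H := fun _ => pathGraph k) (fun _ _ _ h => Or.inl ⟨rfl, h⟩) hF

/-- Beneš routing on all levels at once, while the levels are moved about by the steps `Ms`. -/
theorem routable_levels {Ms : List (Perm (Fin k))} (hMs : ∀ M ∈ Ms, IsStep (pathGraph k) M)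
    {γ : Perm (Core k)} (hlev : ∀ x, (γ x).2 = x.2)
    (hdim : ∀ x d, ¬ Visits Ms x.2 d → (γ x).1 d = x.1 d) :
    Routable (graph k) (4 * Ms.length) γ := by
  induction Ms generalizing γ with
  | nil =>
    have : γ = 1 := Equiv.ext fun x =>
      Sigma.ext (funext fun d => hdim x d id) (heq_of_eq (hlev x))
    rw [this]
    exact .zero
  | cons M Ms ih =>
    have hM := hMs M List.mem_cons_self
    -- The looping step of Beneš routing: `c` is the current coordinate with which a token is to
    -- travel. Cross neighbours need different values, both where they start and where they are
    -- going.
    obtain ⟨c, hc, hc'⟩ := exists_two_coloring cross_cross cross_ne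
      (ρ' := fun x => γ.symm (cross (γ x))) (fun x => by simp [cross_cross])
      (fun x h => cross_ne (γ x) ((symm_apply_eq γ).1 h))
    have hc'' : ∀ y, c (γ.symm (cross y)) ≠ c (γ.symm y) := fun y => by
      simpa using hc' (γ.symm y)
    let A : Perm (Core k) := (switchFun_involutive hc).toPerm
    let B : Perm (Core k) :=
      (switchFun_involutive (c := fun y => c (γ.symm y)) hc'').toPerm
    have hA : IsStep (graph k) A := isStep_switch hc
    have hB : IsStep (graph k) B := isStep_switch (c := fun y => c (γ.symm y)) hc''
    have hBx : ∀ y, B y = switchFun (fun y => c (γ.symm y)) y := fun y => rfl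
    have hAx : ∀ y, A y = switchFun c y := fun y => rfl
    let N : Perm (Core k) := Perm.sigmaCongrRight fun _ => M
    have hN : IsStep (graph k) N := by
      intro x
      refine ⟨Sigma.ext rfl (heq_of_eq (hM x.2).1), ?_⟩
      rcases (hM x.2).2 with h | h
      · exact Or.inl (Sigma.ext rfl (heq_of_eq h))
      · exact Or.inr (Or.inl ⟨rfl, h⟩)
    have hNx : ∀ x, N x = ⟨x.1, M x.2⟩ := fun x => rfl
    -- The switches `A` and `B` and the two level moves `N` account for four steps per element of
    -- `Ms`.
    have hprod : γ = B * (N * ((N * (B * γ * A) * N) * (N * A))) := by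
      ext1 x
      simp only [Perm.mul_apply, (hA _).1, (hB _).1, (hN _).1]
    have key : ∀ x, ((B * γ * A) x).2 = x.2 := by
      intro x
      simp only [Perm.mul_apply, hBx, hAx, switchFun_snd, hlev]
    have key2 : ∀ x d, ¬ Visits Ms (M x.2) d → ((B * γ * A) x).1 d = x.1 d := by
      intro x d hd
      obtain ⟨y, rfl⟩ := A.surjective x
      have e1 : (B * γ * A) (A y) = B (γ y) := by simp only [Perm.mul_apply, (hA _).1]
      rw [e1]
      -- In the dimension of the current level both switches have set the coordinate to `c y`, so
      -- this dimension need not be visited again.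
      by_cases hdy : d = y.2
      · subst hdy
        have h1 := switchFun_fst_self (fun y => c (γ.symm y)) (γ y)
        have h2 := switchFun_fst_self c y
        rw [hlev] at h1
        rw [hBx, hAx, h1, h2]
        simp
      · rw [hBx, hAx, switchFun_fst_of_ne _ _ (by rwa [hlev]), switchFun_fst_of_ne _ _ hdy]
        apply hdim
        rw [hAx, switchFun_snd] at hd
        exact fun h => h.elim (fun h => hdy h.symm) hd
    have hrec : Routable (graph k) (4 * Ms.length) (N * (B * γ * A) * N) := by
      refine ih (fun M' hM' => hMs M' (List.mem_cons_of_mem _ hM')) (fun x => ?_) fun x d hd => ?_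
      · rw [Perm.mul_apply, Perm.mul_apply, hNx, hNx, key]
        exact (hM x.2).1
      · rw [Perm.mul_apply, Perm.mul_apply, hNx, hNx]
        refine key2 ⟨x.1, M x.2⟩ d ?_
        rwa [(hM x.2).1]
    rw [hprod]
    refine ((Routable.of_step hB).mul ((Routable.of_step hN).mul (hrec.mul
      ((Routable.of_step hN).mul (Routable.of_step hA))))).mono ?_
    rw [List.length_cons]
    omega

/-- Every permutation of the cube-connected paths is routed in time linear in the dimension. -/
theorem routable (σ : Perm (Core k)) : Routable (graph k) (16 * k) σ := by
  have hfib : ∀ τ : Perm (Core k), ∀ x ∈ (univ : Finset (Core k)),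
      #{x' ∈ univ | (τ x').1 = (τ x).1} = k := by
    intro τ x _
    have : ({x' ∈ univ | (τ x').1 = (τ x).1} : Finset (Core k)) =
        univ.image fun i : Fin k => τ.symm ⟨(τ x).1, i⟩ := by
      ext y
      simp only [mem_filter, mem_univ, true_and, mem_image]
      constructor
      · intro h
        exact ⟨(τ y).2, by rw [← h]; simp⟩
      · rintro ⟨i, rfl⟩
        simp
    rw [this, card_image_of_injective, card_univ, Fintype.card_fin]
    intro i j hij
    simpa using hij
  -- A token is an edge from its source column to its target column, and its colour is the level on
  -- which it travels. In every column, at source and at target, each level is then used exactly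
  -- once.
  obtain ⟨c, hc, hcf, hcg⟩ := exists_edge_coloring (fun x : Core k => x.1)
    (fun x => (σ x).1) k univ (hfib 1) (hfib σ)
  let c' : Core k → Fin k := fun x => ⟨c x, hc x (mem_univ _)⟩
  have hα : ∀ w, Function.Bijective fun i => c' ⟨w, i⟩ := fun w =>
    Finite.injective_iff_bijective.1 fun i j hij => by
      have := hcf ⟨w, i⟩ (mem_univ _) ⟨w, j⟩ (mem_univ _) (Fin.ext_iff.1 hij) rfl
      simpa using this
  have hβ : ∀ w, Function.Bijective fun i => c' (σ.symm ⟨w, i⟩) := fun w =>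
    Finite.injective_iff_bijective.1 fun i j hij => by
      have := hcg (σ.symm ⟨w, i⟩) (mem_univ _) (σ.symm ⟨w, j⟩) (mem_univ _) (Fin.ext_iff.1 hij)
        (by simp)
      simpa using this
  let α : Perm (Core k) := Perm.sigmaCongrRight fun w => Equiv.ofBijective _ (hα w)
  let β : Perm (Core k) := Perm.sigmaCongrRight fun w => Equiv.ofBijective _ (hβ w)
  have hαr : Routable (graph k) (4 * k) α := routable_columns fun w => routable_pathGraph _
  have hβr : Routable (graph k) (4 * k) β := routable_columns fun w => routable_pathGraph _
  have hαx : ∀ x, α x = ⟨x.1, c' x⟩ := fun x => rfl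
  have hβx : ∀ x, β (σ x) = ⟨(σ x).1, c' x⟩ := fun x => by
    have : β (σ x) = ⟨(σ x).1, c' (σ.symm (σ x))⟩ := rfl
    rw [this, symm_apply_apply]
  have hγ : Routable (graph k) (4 * (2 * k)) (β * σ * α⁻¹) := by
    rw [← length_bricks k (2 * k) 0]
    refine routable_levels isStep_of_mem_bricks (fun x => ?_)
      fun x d h => absurd (visits_bricks_two_mul _ _) h
    obtain ⟨y, rfl⟩ := α.surjective x
    rw [Perm.mul_apply, Perm.mul_apply, Perm.inv_def, symm_apply_apply, hαx, hβx]
  have : σ = β⁻¹ * (β * σ * α⁻¹ * α) := by group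
  rw [this]
  exact (hβr.inv.mul (hγ.mul hαr)).mono (by omega)

end Core

end QRouting

/-! ### Routing pairings: tails on the cube-connected paths. -/

namespace QRouting

open Equiv SimpleGraph Finset

/-- The pairs are pairs of distinct vertices and pairwise disjoint. -/
def IsPairing {V : Type*} (M : Set (V × V)) : Prop :=
  (∀ e ∈ M, e.1 ≠ e.2) ∧
    ∀ e ∈ M, ∀ e' ∈ M, (e.1 = e'.1 ∨ e.1 = e'.2 ∨ e.2 = e'.1 ∨ e.2 = e'.2) → e = e'

/-- The pairs of vertices have `R` colours such that disjoint pairs of the same colour can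
simultaneously be brought to edges of `G` by `T` steps of swaps. -/
def RoutesPairings {V : Type*} (G : SimpleGraph V) (R T : ℕ) : Prop :=
  ∃ κ : V × V → Fin R, ∀ M : Set (V × V), IsPairing M → ∀ c, (∀ e ∈ M, κ e = c) →
    ∃ σ : Perm V, Routable G T σ ∧ ∀ e ∈ M, G.Adj (σ e.1) (σ e.2)

theorem RoutesPairings.of_le {V : Type*} {G G' : SimpleGraph V} {R T : ℕ}
    (h : RoutesPairings G R T) (hG : G ≤ G') : RoutesPairings G' R T := by
  obtain ⟨κ, h⟩ := h
  refine ⟨κ, fun M hM c hc => ?_⟩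
  obtain ⟨σ, hσ, hadj⟩ := h M hM c hc
  exact ⟨σ, hσ.of_le hG, fun e he => hG (hadj e he)⟩

theorem RoutesPairings.map {V V' : Type*} {G : SimpleGraph V} {R T : ℕ}
    (h : RoutesPairings G R T) (e : V ≃ V') : RoutesPairings (G.map e.toEmbedding) R T := by
  obtain ⟨κ, h⟩ := h
  refine ⟨fun p => κ (e.symm p.1, e.symm p.2), fun M hM c hc => ?_⟩
  have hM' : IsPairing {p | (e p.1, e p.2) ∈ M} := by
    refine ⟨fun p hp h => hM.1 _ hp (congrArg e h), fun p hp p' hp' h => ?_⟩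
    have := hM.2 _ hp _ hp' (by simpa using h)
    simp only [Prod.mk.injEq, EmbeddingLike.apply_eq_iff_eq] at this
    exact Prod.ext this.1 this.2
  obtain ⟨σ, hσ, hadj⟩ := h _ hM' c fun p hp => by simpa using hc _ hp
  refine ⟨σ.viaEmbedding e.toEmbedding,
    hσ.viaEmbedding _ fun u v huv => (map_adj_apply (f := e.toEmbedding)).2 huv, fun p hp => ?_⟩
  have h1 : ∀ v, σ.viaEmbedding e.toEmbedding v = e.toEmbedding (σ (e.symm v)) := fun v => by
    rw [← Perm.viaEmbedding_apply]
    simp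
  rw [h1, h1, map_adj_apply]
  exact hadj (e.symm p.1, e.symm p.2) (by simpa using hp)

theorem exists_perm_apply_eq {P ι : Type*} [Finite P] {f g : ι → P} (hf : Function.Injective f)
    (hg : Function.Injective g) : ∃ σ : Perm P, ∀ i, σ (f i) = g i := by
  classical
  let e : {x // x ∈ Set.range f} ≃ {x // x ∈ Set.range g} :=
    (Equiv.ofInjective f hf).symm.trans (Equiv.ofInjective g hg)
  refine ⟨e.extendSubtype, fun i => ?_⟩
  rw [Equiv.extendSubtype_apply_of_mem _ _ ⟨i, rfl⟩]
  have : (Equiv.ofInjective f hf).symm ⟨f i, i, rfl⟩ = i :=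
    (Equiv.ofInjective f hf).symm_apply_apply i
  change ((Equiv.ofInjective g hg) ((Equiv.ofInjective f hf).symm ⟨f i, i, rfl⟩) : P) = g i
  rw [this]
  rfl

/-- For use inside one tail, with `A` marking its only first end and `B` its only second end. -/
theorem exists_perm_zero_one {m : ℕ} (hm : 2 ≤ m) {A B : Fin m → Prop}
    (hA : ∀ i j, A i → A j → i = j) (hB : ∀ i j, B i → B j → i = j) (hAB : ∀ i, A i → ¬ B i) :
    ∃ F : Perm (Fin m), (∀ i, A i → (F i : ℕ) = 0) ∧ ∀ i, B i → (F i : ℕ) = 1 := by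
  let z : Fin m := ⟨0, by omega⟩
  let o : Fin m := ⟨1, by omega⟩
  have hzo : z ≠ o := fun h => by simpa [z, o] using Fin.ext_iff.1 h
  by_cases h1 : ∃ i, A i
  · obtain ⟨i, hi⟩ := h1
    by_cases h2 : ∃ j, B j
    · obtain ⟨j, hj⟩ := h2
      have hij : i ≠ j := fun h => hAB i hi (h ▸ hj)
      -- The first swap may displace `j`, so the second one starts from where `j` is then.
      refine ⟨swap (swap i z j) o * swap i z, fun i' hi' => ?_, fun j' hj' => ?_⟩
      · rw [hA _ _ hi' hi, Perm.mul_apply, swap_apply_left, swap_apply_of_ne_of_ne _ hzo]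
        intro h
        have h3 : swap i z i = swap i z j := by rw [swap_apply_left, ← h]
        exact hij ((swap i z).injective h3)
      · rw [hB _ _ hj' hj, Perm.mul_apply, swap_apply_left]
    · exact ⟨swap i z, fun i' hi' => by rw [hA _ _ hi' hi, swap_apply_left],
        fun j hj => absurd ⟨j, hj⟩ h2⟩
  · by_cases h2 : ∃ j, B j
    · obtain ⟨j, hj⟩ := h2
      exact ⟨swap j o, fun i hi => absurd ⟨i, hi⟩ h1,
        fun j' hj' => by rw [hB _ _ hj' hj, swap_apply_left]⟩
    · exact ⟨1, fun i hi => absurd ⟨i, hi⟩ h1, fun i hi => absurd ⟨i, hi⟩ h2⟩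

/-- The cube-connected paths with a path of `t p` vertices that starts at every vertex `p`. -/
abbrev Tailed (k : ℕ) (t : Core k → ℕ) : Type := Σ p : Core k, Fin (t p)

namespace Tailed

variable {k : ℕ} {t : Core k → ℕ}

theorem ext' {x y : Tailed k t} (h : x.1 = y.1) (h' : (x.2 : ℕ) = y.2) : x = y := by
  obtain ⟨p, i⟩ := x
  obtain ⟨q, j⟩ := y
  obtain rfl : p = q := h
  exact Sigma.ext rfl (heq_of_eq (Fin.ext h'))

/-- The interaction graph before it is made regular. -/
def graph (k : ℕ) (t : Core k → ℕ) : SimpleGraph (Tailed k t) where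
  Adj x y := (x.1 = y.1 ∧ ((x.2 : ℕ) + 1 = y.2 ∨ (y.2 : ℕ) + 1 = x.2)) ∨
    ((x.2 : ℕ) = 0 ∧ (y.2 : ℕ) = 0 ∧ (Core.graph k).Adj x.1 y.1)
  symm := ⟨by
    rintro x y (⟨h, h'⟩ | ⟨h1, h2, h3⟩)
    · exact Or.inl ⟨h.symm, h'.symm⟩
    · exact Or.inr ⟨h2, h1, h3.symm⟩⟩
  loopless := ⟨fun x h => h.elim (fun h => by omega) fun h => h.2.2.ne rfl⟩

/-- Distinguishes the neighbours of a vertex. -/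
def label (x y : Tailed k t) : ℕ :=
  open Classical in
  if y.1 = x.1 then (if (x.2 : ℕ) + 1 = y.2 then 0 else 1)
  else if y.1 = Core.cross x.1 then 2 else if (x.1.2 : ℕ) + 1 = y.1.2 then 3 else 4

/-- The labels stand for up and down the tail, across, and the next and the previous level, each of
which leaves one candidate. Degrees are bounded by counting the labels that can occur. -/
theorem label_injOn (x : Tailed k t) : Set.InjOn (label x) {y | (graph k t).Adj x y} := by
  have key : ∀ y, (graph k t).Adj x y →
      (label x y = 0 ∧ y.1 = x.1 ∧ (y.2 : ℕ) = x.2 + 1) ∨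
      (label x y = 1 ∧ y.1 = x.1 ∧ (y.2 : ℕ) = x.2 - 1) ∨
      (label x y = 2 ∧ y.1 = Core.cross x.1 ∧ (y.2 : ℕ) = 0) ∨
      (label x y = 3 ∧ y.1.1 = x.1.1 ∧ (y.1.2 : ℕ) = x.1.2 + 1 ∧ (y.2 : ℕ) = 0) ∨
      (label x y = 4 ∧ y.1.1 = x.1.1 ∧ (y.1.2 : ℕ) = x.1.2 - 1 ∧ (y.2 : ℕ) = 0) := by
    rintro y (⟨h, h' | h'⟩ | ⟨h1, h2, h3⟩)
    · refine Or.inl ⟨?_, h.symm, h'.symm⟩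
      simp [label, h, h']
    · refine Or.inr (Or.inl ⟨?_, h.symm, by omega⟩)
      rw [label, if_pos h.symm, if_neg (by omega)]
    · have hne : ¬ y.1 = x.1 := h3.ne'
      by_cases hc : y.1 = Core.cross x.1
      · refine Or.inr (Or.inr (Or.inl ⟨?_, hc, h2⟩))
        rw [label, if_neg hne, if_pos hc]
      · rcases h3 with ⟨h3, h4⟩ | h3
        · rw [pathGraph_adj] at h4
          rcases h4 with h4 | h4
          · refine Or.inr (Or.inr (Or.inr (Or.inl ⟨?_, h3.symm, h4.symm, h2⟩)))
            rw [label, if_neg hne, if_neg hc, if_pos h4]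
          · refine Or.inr (Or.inr (Or.inr (Or.inr ⟨?_, h3.symm, by omega, h2⟩)))
            rw [label, if_neg hne, if_neg hc, if_neg (by omega)]
        · exact absurd h3 hc
  intro y hy y' hy' hl
  rcases key y hy with ⟨h, h1, h2⟩ | ⟨h, h1, h2⟩ | ⟨h, h1, h2⟩ | ⟨h, h1, h2, h3⟩ | ⟨h, h1, h2, h3⟩ <;>
  rcases key y' hy' with ⟨h', h1', h2'⟩ | ⟨h', h1', h2'⟩ | ⟨h', h1', h2'⟩ | ⟨h', h1', h2', h3'⟩ |
    ⟨h', h1', h2', h3'⟩ <;>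
  first
  | exact absurd (h.symm.trans (hl.trans h')) (by decide)
  | exact ext' (h1.trans h1'.symm) (h2.trans h2'.symm)
  | exact ext' (Sigma.ext (h1.trans h1'.symm) (heq_of_eq (Fin.ext (h2.trans h2'.symm))))
      (h3.trans h3'.symm)

theorem degree_le_of_label {x : Tailed k t} [DecidableRel (graph k t).Adj] {s : Finset ℕ}
    (h : ∀ y, (graph k t).Adj x y → label x y ∈ s) : (graph k t).degree x ≤ #s := by
  rw [← card_neighborFinset_eq_degree]
  refine card_le_card_of_injOn (label x) (fun y hy => ?_) fun y hy y' hy' => ?_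
  · exact h y (by simpa using hy)
  · exact label_injOn x (by simpa using hy) (by simpa using hy')

theorem degree_le_four [DecidableRel (graph k t).Adj] (x : Tailed k t) :
    (graph k t).degree x ≤ 4 := by
  by_cases hx : (x.2 : ℕ) = 0
  · refine degree_le_of_label (s := {0, 2, 3, 4}) fun y hy => ?_
    have : ¬ (y.1 = x.1 ∧ ¬ (x.2 : ℕ) + 1 = y.2) := by
      rintro ⟨h, h'⟩
      rcases hy with ⟨_, h1 | h1⟩ | ⟨_, _, h1⟩
      · exact h' h1
      · omega
      · exact h1.ne h.symm
    unfold label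
    split_ifs <;> simp_all
  · refine (degree_le_of_label (s := {0, 1}) fun y hy => ?_).trans (by decide)
    rcases hy with ⟨h, _⟩ | h
    · unfold label
      rw [if_pos h.symm]
      split_ifs <;> simp
    · exact absurd h.1 hx

/-- Provides the many vertices of low degree that the completion to a regular graph requires. -/
theorem degree_le_two [DecidableRel (graph k t).Adj] {x : Tailed k t} (hx : (x.2 : ℕ) ≠ 0) :
    (graph k t).degree x ≤ 2 := by
  refine (degree_le_of_label (s := {0, 1}) fun y hy => ?_).trans (by decide)
  rcases hy with ⟨h, _⟩ | h
  · unfold label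
    rw [if_pos h.symm]
    split_ifs <;> simp
  · exact absurd h.1 hx

/-- The colour of a pair records the heights of both ends. In one class all first ends have the same
height, so a tail contains at most one of them, and likewise for second ends. -/
theorem routesPairings {c : ℕ} (ht : ∀ p, 2 ≤ t p ∧ t p ≤ c) :
    RoutesPairings (graph k t) (c * c) (16 * k + 4 * c) := by
  let κ : Tailed k t × Tailed k t → Fin (c * c) := fun e =>
    finProdFinEquiv (⟨e.1.2, e.1.2.2.trans_le (ht _).2⟩, ⟨e.2.2, e.2.2.2.trans_le (ht _).2⟩)
  refine ⟨κ, fun M hM col hcol => ?_⟩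
  have hh : ∀ e ∈ M, ∀ e' ∈ M, (e.1.2 : ℕ) = e'.1.2 ∧ (e.2.2 : ℕ) = e'.2.2 := by
    intro e he e' he'
    have h := finProdFinEquiv.injective ((hcol e he).trans (hcol e' he').symm)
    simpa [Fin.ext_iff] using h
  have hF : ∀ p, ∃ F : Perm (Fin (t p)),
      (∀ i, (∃ e ∈ M, e.1 = ⟨p, i⟩) → (F i : ℕ) = 0) ∧
      ∀ i, (∃ e ∈ M, e.2 = ⟨p, i⟩) → (F i : ℕ) = 1 := by
    intro p
    refine exists_perm_zero_one (ht p).1 ?_ ?_ ?_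
    · rintro i j ⟨e, he, hi⟩ ⟨e', he', hj⟩
      have := (hh e he e' he').1
      rw [hi, hj] at this
      exact Fin.ext this
    · rintro i j ⟨e, he, hi⟩ ⟨e', he', hj⟩
      have := (hh e he e' he').2
      rw [hi, hj] at this
      exact Fin.ext this
    · rintro i ⟨e, he, hi⟩ ⟨e', he', hj⟩
      obtain rfl := hM.2 e he e' he' (Or.inr (Or.inl (hi.trans hj.symm)))
      exact hM.1 e he (hi.trans hj.symm)
  choose F hF0 hF1 using hF
  -- Sends the tail of every first end to the tail of its partner.
  obtain ⟨σ, hσ⟩ := exists_perm_apply_eq (f := fun e : M => e.1.1.1) (g := fun e : M => e.1.2.1)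
    (fun e e' h => Subtype.ext (hM.2 _ e.2 _ e'.2 (Or.inl (ext' h (hh _ e.2 _ e'.2).1))))
    (fun e e' h => Subtype.ext
      (hM.2 _ e.2 _ e'.2 (Or.inr (Or.inr (Or.inr (ext' h (hh _ e.2 _ e'.2).2))))))
  let ι : Core k ↪ Tailed k t := ⟨fun p => ⟨p, 0, by have := (ht p).1; omega⟩, fun p q h =>
    congrArg Sigma.fst h⟩
  have h1 : Routable (graph k t) (16 * k) (σ.viaEmbedding ι) :=
    (Core.routable σ).viaEmbedding ι fun u v huv => Or.inr ⟨rfl, rfl, huv⟩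
  have h2 : Routable (graph k t) (4 * c) (Perm.sigmaCongrRight F) := by
    refine Routable.sigmaCongrRight (H := fun p => pathGraph (t p)) (fun p i j h => ?_) fun p =>
      (routable_pathGraph _).mono (Nat.mul_le_mul_left 4 (ht p).2)
    rw [pathGraph_adj] at h
    exact Or.inl ⟨rfl, h⟩
  refine ⟨_, h1.mul h2, fun e he => ?_⟩
  have e1 : Perm.sigmaCongrRight F e.1 = ι e.1.1 := ext' rfl (hF0 e.1.1 e.1.2 ⟨e, he, rfl⟩)
  have e2 : ((Perm.sigmaCongrRight F e.2).2 : ℕ) = 1 := hF1 e.2.1 e.2.2 ⟨e, he, rfl⟩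
  have e3 : Perm.sigmaCongrRight F e.2 ∉ Set.range ι := by
    rintro ⟨p, hp⟩
    rw [← hp] at e2
    exact absurd e2 (by simp [ι])
  rw [Perm.mul_apply, Perm.mul_apply, e1, Perm.viaEmbedding_apply,
    Perm.viaEmbedding_apply_of_notMem _ _ _ e3]
  refine Or.inl ⟨hσ ⟨e, he⟩, Or.inl ?_⟩
  rw [e2]
  rfl

end Tailed

/-- An even distribution: the quotient lies between 2 and 7, and the remainder adds at most 1. -/
theorem exists_sum_eq {P : Type*} [Fintype P] {n : ℕ} (h2 : 2 * Fintype.card P ≤ n)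
    (h8 : n < 8 * Fintype.card P) : ∃ t : P → ℕ, (∀ p, 2 ≤ t p ∧ t p ≤ 8) ∧ ∑ p, t p = n := by
  have hK : 0 < Fintype.card P := by omega
  let e := Fintype.equivFin P
  have hq2 : 2 ≤ n / Fintype.card P := (Nat.le_div_iff_mul_le hK).2 h2
  have hq8 : n / Fintype.card P < 8 := (Nat.div_lt_iff_lt_mul hK).2 h8
  refine ⟨fun p => n / Fintype.card P + if (e p : ℕ) < n % Fintype.card P then 1 else 0,
    fun p => ?_, ?_⟩
  · dsimp only
    split_ifs <;> omega
  · rw [Equiv.sum_comp e (fun i : Fin (Fintype.card P) =>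
      n / Fintype.card P + if (i : ℕ) < n % Fintype.card P then 1 else 0), sum_add_distrib,
      sum_const, card_univ, Fintype.card_fin, smul_eq_mul,
      Fin.sum_univ_eq_sum_range (fun i => if i < n % Fintype.card P then 1 else 0), sum_boole]
    have : {i ∈ range (Fintype.card P) | i < n % Fintype.card P} =
        range (n % Fintype.card P) := by
      have := Nat.mod_lt n hK
      ext i
      simp only [mem_filter, mem_range]
      omega
    rw [this, card_range]
    exact Nat.div_add_mod n _

/-- The numbers `k * 2 ^ k` grow by a factor of at most 4 from one `k ≥ 1` to the next, so the
largest admissible `k` works. -/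
theorem exists_dimension {n : ℕ} (hn : 4 ≤ n) :
    ∃ k, 1 ≤ k ∧ 2 * (k * 2 ^ k) ≤ n ∧ n < 8 * (k * 2 ^ k) := by
  have hex : ∃ k, n < 2 * ((k + 1) * 2 ^ (k + 1)) := by
    refine ⟨n, ?_⟩
    have : n + 1 ≤ (n + 1) * 2 ^ (n + 1) := Nat.le_mul_of_pos_right _ (by positivity)
    omega
  classical
  have h1 := Nat.find_spec hex
  have h0 : Nat.find hex ≠ 0 := by
    intro h
    rw [h] at h1
    omega
  have h2 := Nat.find_min hex (Nat.sub_one_lt h0)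
  obtain ⟨k, hk⟩ := Nat.exists_eq_succ_of_ne_zero h0
  rw [hk] at h1 h2
  refine ⟨k + 1, by omega, by simpa using h2, h1.trans_le ?_⟩
  have : (k.succ + 1) * 2 ^ (k.succ + 1) = ((k + 1) * 2 ^ (k + 1)) * 2 + 2 ^ (k + 1) * 2 := by
    rw [Nat.succ_eq_add_one]
    ring
  have h3 : 2 ^ (k + 1) ≤ (k + 1) * 2 ^ (k + 1) := Nat.le_mul_of_pos_left _ (by omega)
  omega

end QRouting

/-! ### Completion to a regular graph. -/

namespace QRouting

open SimpleGraph Finset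

section

open scoped Classical

variable {V : Type*} [Fintype V]

theorem degree_sup_edge {G G' : SimpleGraph V} {a b : V} (hG' : G' = G ⊔ edge a b) (hab : a ≠ b)
    (h : ¬ G.Adj a b) (z : V) :
    G'.degree z = G.degree z + ((if z = a then 1 else 0) + if z = b then 1 else 0) := by
  simp only [← card_neighborFinset_eq_degree]
  by_cases ha : z = a
  · subst ha
    rw [if_pos rfl, if_neg hab, add_zero,
      ← card_insert_of_notMem (a := b) (s := G.neighborFinset z) (by simpa using h)]
    congr 1
    ext y
    simp only [mem_neighborFinset, hG', sup_adj, edge_adj, mem_insert]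
    grind
  · by_cases hb : z = b
    · subst hb
      rw [if_pos rfl, if_neg ha, zero_add,
        ← card_insert_of_notMem (a := a) (s := G.neighborFinset z)
          (by simpa using fun h' => h (G.adj_symm h'))]
      congr 1
      ext y
      simp only [mem_neighborFinset, hG', sup_adj, edge_adj, mem_insert]
      grind
    · rw [if_neg ha, if_neg hb, add_zero, add_zero]
      congr 1
      ext y
      simp only [mem_neighborFinset, hG', sup_adj, edge_adj]
      grind

theorem sum_ite_add_ite (a b : V) :
    ∑ z, ((if z = a then 1 else 0) + if z = b then 1 else 0) = 2 := by
  simp [sum_add_distrib]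

/-- A graph of maximal degree at most `r` all but few of whose vertices have degree `r` can be
completed to an `r`-regular graph if there are sufficiently many vertices of degree less than
`r`. -/
theorem exists_regular_supergraph {H : SimpleGraph V} {r : ℕ} (hH : ∀ v, H.degree v ≤ r)
    (heven : Even (Fintype.card V * r))
    (hlow : 2 * r * r + 3 * r < #{v | H.degree v < r}) :
    ∃ G : SimpleGraph V, H ≤ G ∧ G.IsRegularOfDegree r := by
  -- A supergraph with as many edges as possible under the degree bound; `noimp` says that no two
  -- units of deficiency can be filled.
  obtain ⟨G, ⟨hHG, hG⟩, hmax⟩ := Set.exists_max_image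
    {G : SimpleGraph V | H ≤ G ∧ ∀ v, G.degree v ≤ r} (fun G => ∑ v, G.degree v)
    (Set.toFinite _) ⟨H, le_rfl, hH⟩
  refine ⟨G, hHG, ?_⟩
  have noimp : ∀ (G' : SimpleGraph V) (a b : V), H ≤ G' →
      (∀ z, G'.degree z = G.degree z + ((if z = a then 1 else 0) + if z = b then 1 else 0)) →
      G.degree a < r → G.degree b < r → (a = b → G.degree a + 2 ≤ r) → False := by
    intro G' a b hHG' hdeg ha hb hab
    have h1 := hmax G' ⟨hHG', fun z => ?_⟩
    · simp only [hdeg] at h1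
      rw [sum_add_distrib, sum_ite_add_ite] at h1
      omega
    · rw [hdeg]
      have := hG z
      split_ifs with h1 h2 h2
      · have := hab (h1.symm.trans h2)
        subst h1
        omega
      · subst h1
        omega
      · subst h2
        omega
      · omega
  have hclique : ∀ a b, G.degree a < r → G.degree b < r → a ≠ b → G.Adj a b := by
    intro a b ha hb hab
    by_contra h
    obtain ⟨G', hG'⟩ : ∃ G', G' = G ⊔ edge a b := ⟨_, rfl⟩
    exact noimp G' a b (hHG.trans (hG' ▸ le_sup_left)) (degree_sup_edge hG' hab h) ha hb
      fun h => absurd h hab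
  by_contra hreg
  obtain ⟨u, hu⟩ : ∃ u, G.degree u < r := by
    by_contra! h
    exact hreg fun v => le_antisymm (hG v) (h v)
  -- By parity the total deficiency cannot be 1. The second unit may sit at `u` itself.
  obtain ⟨v, hv, huv⟩ : ∃ v, G.degree v < r ∧ (u = v → G.degree u + 2 ≤ r) := by
    by_cases h2 : G.degree u + 2 ≤ r
    · exact ⟨u, hu, fun _ => h2⟩
    · by_contra! h
      have hall : ∀ z, G.degree z + (if z = u then 1 else 0) = r := by
        intro z
        split_ifs with hz
        · subst hz
          omega
        · by_contra h'
          have hz' : G.degree z < r := by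
            have := hG z
            omega
          exact hz (h z hz').1.symm
      have h3 : ∑ z, (G.degree z + if z = u then 1 else 0) = Fintype.card V * r := by
        simp only [hall, sum_const, card_univ, smul_eq_mul]
      rw [sum_add_distrib, G.sum_degrees_eq_twice_card_edges] at h3
      simp only [sum_ite_eq', mem_univ, if_true] at h3
      rw [← h3] at heven
      exact absurd heven (by simp)
  let N : V → Finset V := fun z => insert z (G.neighborFinset z)
  have hN : ∀ z, #(N z) ≤ G.degree z + 1 := fun z => by
    rw [← card_neighborFinset_eq_degree]
    exact card_insert_le _ _
  let B : Finset V := N u ∪ N v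
  have hB : #B ≤ 2 * r := by
    have : #B ≤ #(N u) + #(N v) := card_union_le _ _
    have := hN u
    have := hN v
    omega
  let D : Finset V := {z | G.degree z < r}
  have hD : #D ≤ r := by
    have : D ⊆ N u := by
      intro z hz
      by_cases h : z = u
      · exact h ▸ mem_insert_self _ _
      · exact mem_insert_of_mem (by
          simpa using hclique u z hu (mem_filter.1 hz).2 (Ne.symm h))
    have := card_le_card this
    have := hN u
    omega
  let B' : Finset V := B.biUnion fun z => G.neighborFinset z
  have hB' : #B' ≤ 2 * r * r :=
    (card_biUnion_le_card_mul B _ r fun z _ => by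
      rw [card_neighborFinset_eq_degree]
      exact hG z).trans (Nat.mul_le_mul_right r hB)
  -- `x` has full degree in `G` but not in `H`, so it has an added edge to some `y`. Avoiding `B`
  -- and `B'` keeps `x` and `y` away from `u`, `v` and their neighbours, so `xy` can be replaced by
  -- `ux` and `vy`.
  obtain ⟨x, hxlow, hx⟩ : ∃ x ∈ ({v | H.degree v < r} : Finset V), x ∉ D ∪ (B ∪ B') := by
    refine exists_mem_notMem_of_card_lt_card (lt_of_le_of_lt ?_ hlow)
    have := card_union_le D (B ∪ B')
    have := card_union_le B B'
    omega
  rw [mem_union, mem_union, not_or, not_or] at hx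
  obtain ⟨hxD, hxB, hxB'⟩ := hx
  obtain ⟨y, hyG, hyH⟩ : ∃ y ∈ G.neighborFinset x, y ∉ H.neighborFinset x := by
    refine exists_mem_notMem_of_card_lt_card ?_
    rw [card_neighborFinset_eq_degree, card_neighborFinset_eq_degree]
    refine (mem_filter.1 hxlow).2.trans_le ?_
    by_contra h
    exact hxD (mem_filter.2 ⟨mem_univ _, not_le.1 h⟩)
  rw [mem_neighborFinset] at hyG hyH
  have hyB : y ∉ B := fun h => hxB' (mem_biUnion.2 ⟨y, h, by simpa using hyG.symm⟩)
  have hBu : ∀ z, z ∉ B → u ≠ z ∧ ¬ G.Adj u z ∧ v ≠ z ∧ ¬ G.Adj v z := by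
    intro z hz
    simp only [B, N, mem_union, mem_insert, mem_neighborFinset, not_or] at hz
    exact ⟨Ne.symm hz.1.1, hz.1.2, Ne.symm hz.2.1, hz.2.2⟩
  obtain ⟨hux, hux', hvx, -⟩ := hBu x hxB
  obtain ⟨-, -, hvy, hvy'⟩ := hBu y hyB
  have hle : edge x y ≤ G := (edge_le_iff G).2 (Or.inr hyG)
  obtain ⟨G₀, hG₀⟩ : ∃ G', G' = G \ edge x y := ⟨_, rfl⟩
  obtain ⟨G₁, hG₁⟩ : ∃ G', G' = G₀ ⊔ edge u x := ⟨_, rfl⟩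
  obtain ⟨G₂, hG₂⟩ : ∃ G', G' = G₁ ⊔ edge v y := ⟨_, rfl⟩
  have hsplit : G = G₀ ⊔ edge x y := by rw [hG₀, sdiff_sup_cancel hle]
  have d0 := degree_sup_edge hsplit hyG.ne (by
    rw [hG₀]
    exact fun h => h.2 (by rw [edge_adj]; exact ⟨Or.inl ⟨rfl, rfl⟩, hyG.ne⟩))
  have d1 := degree_sup_edge hG₁ hux (by
    rw [hG₀]
    exact fun h => hux' h.1)
  have d2 := degree_sup_edge hG₂ hvy (by
    rw [hG₁, hG₀]
    rintro (h | h)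
    · exact hvy' h.1
    · rw [edge_adj] at h
      rcases h.1 with ⟨_, h⟩ | ⟨h, _⟩
      · exact hyG.ne h.symm
      · exact hvx h)
  refine noimp G₂ u v ?_ (fun z => ?_) hu hv huv
  · rw [hG₂, hG₁, hG₀]
    intro a b hab
    refine Or.inl (Or.inl ⟨hHG hab, fun h => ?_⟩)
    rw [edge_adj] at h
    rcases h.1 with ⟨rfl, rfl⟩ | ⟨rfl, rfl⟩
    · exact hyH hab
    · exact hyH hab.symm
  · have e0 := d0 z
    have e1 := d1 z
    have e2 := d2 z
    omega

end

end QRouting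

/-! ### The regular graphs for small and for large `n`. -/

namespace QRouting

open SimpleGraph Finset

/-- The connection set of a circulant graph of degree `r` on `n` vertices. -/
def connectionSet (n r : ℕ) : Finset (Fin n) :=
  {x | (x : ℕ) ≠ 0 ∧ ((x : ℕ) ≤ r / 2 ∨ n ≤ x + r / 2 ∨ (r % 2 = 1 ∧ 2 * (x : ℕ) = n))}

theorem card_connectionSet {n r : ℕ} (hrn : r < n) (he : Even (n * r)) :
    #(connectionSet n r) = r := by
  have hodd : r % 2 = 1 → n % 2 = 0 := by
    intro h
    rcases Nat.even_mul.1 he with h' | h'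
    · exact Nat.even_iff.1 h'
    · rw [Nat.even_iff] at h'
      omega
  have h1 : #(connectionSet n r) = #((connectionSet n r).map Fin.valEmbedding) := (card_map _).symm
  have h2 : (connectionSet n r).map Fin.valEmbedding =
      (Icc 1 (r / 2) ∪ Ico (n - r / 2) n) ∪ if r % 2 = 1 then {n / 2} else ∅ := by
    ext x
    simp only [Finset.mem_map, connectionSet, mem_filter, mem_univ, true_and, mem_union, mem_Icc,
      mem_Ico, Fin.valEmbedding_apply]
    constructor
    · rintro ⟨y, ⟨h0, h⟩, rfl⟩
      have := y.2
      split_ifs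
      · rw [mem_singleton]
        omega
      · rcases h with h | h | h
        · omega
        · omega
        · omega
    · intro h
      have hx : x ≠ 0 ∧ x < n ∧ (x ≤ r / 2 ∨ n ≤ x + r / 2 ∨ (r % 2 = 1 ∧ 2 * x = n)) := by
        split_ifs at h
        · rw [mem_singleton] at h
          omega
        · simp only [notMem_empty, or_false] at h
          omega
      exact ⟨⟨x, hx.2.1⟩, ⟨hx.1, hx.2.2⟩, rfl⟩
  rw [h1, h2, card_union_of_disjoint, card_union_of_disjoint, Nat.card_Icc, Nat.card_Ico]
  · split_ifs
    · rw [card_singleton]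
      omega
    · rw [card_empty]
      omega
  · rw [Finset.disjoint_left]
    intro x hx hx'
    rw [mem_Icc] at hx
    rw [mem_Ico] at hx'
    omega
  · rw [Finset.disjoint_left]
    intro x hx hx'
    rw [mem_union, mem_Icc, mem_Ico] at hx
    split_ifs at hx'
    · rw [mem_singleton] at hx'
      omega
    · exact notMem_empty x hx'

theorem neg_mem_connectionSet {n r : ℕ} [NeZero n] {x : Fin n} (hx : x ∈ connectionSet n r) :
    -x ∈ connectionSet n r := by
  simp only [connectionSet, mem_filter, mem_univ, true_and] at hx ⊢
  have h0 : x ≠ 0 := fun h => hx.1 (by rw [h]; rfl)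
  rw [Fin.val_neg, if_neg h0]
  have := x.2
  omega

/-- There is a regular graph of every possible degree that contains a Hamiltonian path. -/
theorem exists_regular_pathGraph_le {n r : ℕ} (hr : 2 ≤ r) (hrn : r < n) (he : Even (n * r)) :
    ∃ (G : SimpleGraph (Fin n)) (_ : DecidableRel G.Adj), pathGraph n ≤ G ∧
      G.IsRegularOfDegree r := by
  have : NeZero n := ⟨by omega⟩
  let G : SimpleGraph (Fin n) :=
    { Adj := fun a b => b - a ∈ connectionSet n r
      symm := ⟨fun a b h => by
        have := neg_mem_connectionSet h
        rwa [neg_sub] at this⟩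
      loopless := ⟨fun a h => by
        rw [sub_self] at h
        exact (mem_filter.1 h).2.1 rfl⟩ }
  have dec : DecidableRel G.Adj := fun a b =>
    inferInstanceAs (Decidable (b - a ∈ connectionSet n r))
  refine ⟨G, dec, ?_, fun v => ?_⟩
  · have key : ∀ a b : Fin n, (a : ℕ) + 1 = b → G.Adj a b := by
      intro a b h
      change b - a ∈ connectionSet n r
      have h1 : ((b - a : Fin n) : ℕ) = b - a := Fin.sub_val_of_le (Fin.le_def.2 (by omega))
      simp only [connectionSet, mem_filter, mem_univ, true_and, h1]
      omega
    intro a b h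
    rw [pathGraph_adj] at h
    exact h.elim (key a b) fun h => (key b a h).symm
  · refine (card_neighborFinset_eq_degree _ _).symm.trans (Eq.trans ?_
      ((card_map (Equiv.addLeft v).toEmbedding).trans (card_connectionSet hrn he)))
    congr 1
    ext w
    rw [mem_neighborFinset, mem_map_equiv]
    change w - v ∈ _ ↔ -v + w ∈ _
    rw [neg_add_eq_sub]

/-- On a graph with a Hamiltonian path one pair after the other can be brought to an edge. -/
theorem routesPairings_of_pathGraph_le {n : ℕ} (hn : 2 ≤ n) {G : SimpleGraph (Fin n)}
    (hG : pathGraph n ≤ G) : RoutesPairings G (n * n) (4 * n) := by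
  refine RoutesPairings.of_le ⟨finProdFinEquiv, fun M hM c hc => ?_⟩ hG
  by_cases h : ∃ e, e ∈ M
  · obtain ⟨e, he⟩ := h
    obtain ⟨σ, h0, h1⟩ := exists_perm_zero_one hn (A := fun i => i = e.1) (B := fun i => i = e.2)
      (fun i j hi hj => hi.trans hj.symm) (fun i j hi hj => hi.trans hj.symm)
      (fun i hi hi' => hM.1 e he (hi.symm.trans hi'))
    refine ⟨σ, routable_pathGraph σ, fun e' he' => ?_⟩
    obtain rfl := finProdFinEquiv.injective ((hc e he).trans (hc e' he').symm)
    rw [pathGraph_adj, h0 _ rfl, h1 _ rfl]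
    exact Or.inl rfl
  · exact ⟨1, Routable.one _, fun e he => absurd ⟨e, he⟩ h⟩

open scoped Classical in
/-- On sufficiently many vertices there is a regular graph that routes pairings in logarithmic
time. -/
theorem exists_regular_routesPairings {n r : ℕ} (hr : 4 ≤ r)
    (hn : 8 * (2 * r * r + 3 * r) + 8 ≤ n) (he : Even (n * r)) :
    ∃ (k : ℕ) (G : SimpleGraph (Fin n)), 1 ≤ k ∧ 2 ^ k ≤ n ∧ G.IsRegularOfDegree r ∧
      RoutesPairings G 64 (16 * k + 32) := by
  obtain ⟨k, hk, h2, h8⟩ := exists_dimension (n := n) (by omega)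
  have hcard : Fintype.card (Core k) = k * 2 ^ k := by
    simp [mul_comm]
  rw [← hcard] at h2 h8
  obtain ⟨t, ht, hsum⟩ := exists_sum_eq h2 h8
  have hV : Fintype.card (Tailed k t) = n := by
    rw [Fintype.card_sigma, ← hsum]
    simp
  -- The vertices of height 1, one per core vertex, have degree at most 2, and there are more than
  -- `n / 8` of them.
  obtain ⟨G, hHG, hG⟩ := exists_regular_supergraph (H := Tailed.graph k t) (r := r)
    (fun v => (Tailed.degree_le_four v).trans hr) (by rwa [hV]) (by
      let ι : Core k ↪ Tailed k t := ⟨fun p => ⟨p, 1, by have := (ht p).1; omega⟩, fun p q h =>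
        congrArg Sigma.fst h⟩
      have h1 : univ.map ι ⊆ ({v | (Tailed.graph k t).degree v < r} : Finset _) := by
        intro x hx
        obtain ⟨p, _, rfl⟩ := Finset.mem_map.1 hx
        refine mem_filter.2 ⟨mem_univ _, (Tailed.degree_le_two ?_).trans_lt (by omega)⟩
        exact one_ne_zero
      have h3 := card_le_card h1
      rw [card_map, card_univ] at h3
      omega)
  let e : Tailed k t ≃ Fin n := Fintype.equivFinOfCardEq hV
  refine ⟨k, G.map e.toEmbedding, hk, ?_, fun v => ?_, ?_⟩
  · have : 2 ^ k ≤ k * 2 ^ k := Nat.le_mul_of_pos_left _ hk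
    omega
  · rw [← e.apply_symm_apply v, ← hG (e.symm v)]
    convert (Iso.map e G).degree_eq (e.symm v) <;> rfl
  · exact ((Tailed.routesPairings ht).of_le hHG).map e

end QRouting

/-! ### Action of compiled operations on states. -/

namespace QRouting

open Equiv

section Semantics

variable {Q V : Type*} [DecidableEq V]

theorem Op.positions_append (p : Q ≃ V) (l l' : List (Op V)) :
    Op.positions p (l ++ l') = Op.positions (Op.positions p l) l' := by
  induction l generalizing p with
  | nil => rfl
  | cons o l ih =>
    cases o with
    | swap u v h => exact ih _
    | gate g => exact ih _

theorem Op.performed_append (p : Q ≃ V) (l l' : List (Op V)) :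
    Op.performed p (l ++ l') = Op.performed p l ++ Op.performed (Op.positions p l) l' := by
  induction l generalizing p with
  | nil => rfl
  | cons o l ih =>
    cases o with
    | swap u v h => exact ih _
    | gate g => exact congrArg _ (ih _)

variable [DecidableEq Q]

theorem Gate.apply_place (p : Q ≃ V) (g : Gate V) (ψ : State Q) :
    g.apply (place p ψ) = place p ((g.relabel p.symm).apply ψ) := by
  funext x
  simp only [Gate.apply, place, Gate.relabel, Function.comp_apply, apply_symm_apply]
  refine Finset.sum_congr rfl fun s _ => ?_
  congr 2
  rw [Function.update_comp_equiv, Function.update_comp_equiv]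

/-- Swaps only change the placement, so the machine state is always the placed state of the gates
performed so far. -/
theorem Op.foldl_apply_place (l : List (Op V)) (p : Q ≃ V) (ψ : State Q) :
    l.foldl (fun φ o => o.apply φ) (place p ψ) =
      place (Op.positions p l) ((Op.performed p l).foldl (fun φ g => g.apply φ) ψ) := by
  induction l generalizing p ψ with
  | nil => rfl
  | cons o l ih =>
    cases o with
    | swap u v h => exact ih (p.trans (Equiv.swap u v)) ψ
    | gate g =>
      rw [List.foldl_cons]
      change List.foldl _ (g.apply (place p ψ)) l = _
      rw [Gate.apply_place, ih]
      rfl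

theorem Gate.apply_comm {g h : Gate Q} (hd : g.Disjoint h) (ψ : State Q) :
    g.apply (h.apply ψ) = h.apply (g.apply ψ) := by
  have h1 : g.fst ≠ h.fst := fun e => hd h.fst ⟨Or.inl e, Or.inl rfl⟩
  have h2 : g.fst ≠ h.snd := fun e => hd h.snd ⟨Or.inl e, Or.inr rfl⟩
  have h3 : g.snd ≠ h.fst := fun e => hd h.fst ⟨Or.inr e, Or.inl rfl⟩
  have h4 : g.snd ≠ h.snd := fun e => hd h.snd ⟨Or.inr e, Or.inr rfl⟩
  funext x
  simp only [Gate.apply, Finset.mul_sum]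
  rw [Finset.sum_comm]
  refine Finset.sum_congr rfl fun s _ => Finset.sum_congr rfl fun s' _ => ?_
  have e1 : ∀ s : Fin 2 × Fin 2,
      Function.update (Function.update x g.fst s.1) g.snd s.2 h.fst = x h.fst := fun s => by
    rw [Function.update_of_ne h3.symm, Function.update_of_ne h1.symm]
  have e2 : ∀ s : Fin 2 × Fin 2,
      Function.update (Function.update x g.fst s.1) g.snd s.2 h.snd = x h.snd := fun s => by
    rw [Function.update_of_ne h4.symm, Function.update_of_ne h2.symm]
  have e3 : ∀ s : Fin 2 × Fin 2,
      Function.update (Function.update x h.fst s.1) h.snd s.2 g.fst = x g.fst := fun s => by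
    rw [Function.update_of_ne h2, Function.update_of_ne h1]
  have e4 : ∀ s : Fin 2 × Fin 2,
      Function.update (Function.update x h.fst s.1) h.snd s.2 g.snd = x g.snd := fun s => by
    rw [Function.update_of_ne h4, Function.update_of_ne h3]
  have e5 : ∀ s s' : Fin 2 × Fin 2,
      Function.update (Function.update (Function.update (Function.update x g.fst s.1) g.snd s.2)
        h.fst s'.1) h.snd s'.2 =
      Function.update (Function.update (Function.update (Function.update x h.fst s'.1) h.snd s'.2)
        g.fst s.1) g.snd s.2 := fun s s' => by
    rw [Function.update_comm h3, Function.update_comm h4, Function.update_comm h1,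
      Function.update_comm h2]
  rw [e1, e2, e3, e4, e5]
  ring

theorem Gate.foldl_apply_perm {L L' : List (Gate Q)} (hp : L.Perm L')
    (hL : L.Pairwise Gate.Disjoint) (ψ : State Q) :
    L.foldl (fun φ g => g.apply φ) ψ = L'.foldl (fun φ g => g.apply φ) ψ := by
  refine hp.foldl_eq' (fun g hg h hh φ => ?_) ψ
  by_cases hgh : g = h
  · rw [hgh]
  · have : Std.Symm (Gate.Disjoint (Q := Q)) := ⟨fun a b hab q hq => hab q ⟨hq.2, hq.1⟩⟩
    exact Gate.apply_comm (hL.forall hh hg (Ne.symm hgh)) φ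

end Semantics

end QRouting

/-! ### From routing to compilation. -/

namespace QRouting

open Equiv

/-- Disjoint swaps that exchange `x` and `τ x` for the listed `x`. -/
def swapOps {n : ℕ} {τ : Perm (Fin n)} (l : List {x // x < τ x}) : List (Op (Fin n)) :=
  l.map fun x => Op.swap x.1 (τ x.1) x.2.ne

/-- The condition `x < τ x` selects one element of each exchanged pair, so no position is touched by
two of the swaps. -/
theorem positions_swapOps {n : ℕ} {τ : Perm (Fin n)} (hτ : ∀ x, τ (τ x) = x)
    (l : List {x // x < τ x}) (hl : l.Nodup) (p : Perm (Fin n)) (q : Fin n) :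
    ((∃ x ∈ l, p q = x.1 ∨ p q = τ x.1) → Op.positions p (swapOps l) q = τ (p q)) ∧
    ((¬ ∃ x ∈ l, p q = x.1 ∨ p q = τ x.1) → Op.positions p (swapOps l) q = p q) := by
  induction l generalizing p with
  | nil => exact ⟨fun ⟨x, hx, _⟩ => absurd hx List.not_mem_nil, fun _ => rfl⟩
  | cons x l ih =>
    rw [List.nodup_cons] at hl
    have ih := ih hl.2 (p.trans (swap x.1 (τ x.1)))
    change (_ → Op.positions (p.trans (swap x.1 (τ x.1))) (swapOps l) q = _) ∧
      (_ → Op.positions (p.trans (swap x.1 (τ x.1))) (swapOps l) q = _)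
    by_cases h1 : p q = x.1
    · refine ⟨fun _ => ?_, fun h => absurd ⟨x, List.mem_cons_self, Or.inl h1⟩ h⟩
      have e : (p.trans (swap x.1 (τ x.1))) q = τ x.1 := by
        rw [trans_apply, h1, swap_apply_left]
      rw [ih.2 ?_, e, h1]
      rw [e]
      rintro ⟨y, hy, h | h⟩
      · have h2 := y.2
        rw [← h, hτ] at h2
        exact lt_asymm h2 x.2
      · exact hl.1 (Subtype.ext (τ.injective h) ▸ hy)
    · by_cases h2 : p q = τ x.1
      · refine ⟨fun _ => ?_, fun h => absurd ⟨x, List.mem_cons_self, Or.inr h2⟩ h⟩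
        have e : (p.trans (swap x.1 (τ x.1))) q = x.1 := by
          rw [trans_apply, h2, swap_apply_right]
        rw [ih.2 ?_, e, h2, hτ]
        rw [e]
        rintro ⟨y, hy, h | h⟩
        · exact hl.1 (Subtype.ext h ▸ hy)
        · have h3 := x.2
          rw [h, hτ] at h3
          exact lt_asymm h3 y.2
      · have e : (p.trans (swap x.1 (τ x.1))) q = p q := by
          rw [trans_apply, swap_apply_of_ne_of_ne h1 h2]
        rw [e] at ih
        refine ⟨?_, fun h => ih.2 fun ⟨y, hy, h'⟩ => h ⟨y, List.mem_cons_of_mem _ hy, h'⟩⟩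
        rintro ⟨y, hy, h⟩
        rcases List.mem_cons.1 hy with rfl | hy
        · exact absurd h (not_or.2 ⟨h1, h2⟩)
        · exact ih.1 ⟨y, hy, h⟩

theorem performed_swapOps {n : ℕ} {τ : Perm (Fin n)} (l : List {x // x < τ x})
    (p : Perm (Fin n)) : Op.performed p (swapOps l) = [] := by
  induction l generalizing p with
  | nil => rfl
  | cons x l ih => exact ih _

theorem exists_swap_layer {n : ℕ} {G : SimpleGraph (Fin n)} {τ : Perm (Fin n)}
    (h : IsStep G τ) : ∃ S : List (Op (Fin n)), (∀ o ∈ S, G.Adj o.fst o.snd) ∧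
      S.Pairwise Op.Disjoint ∧ ∀ p : Perm (Fin n), Op.positions p S = p.trans τ ∧
        Op.performed p S = [] := by
  have hτ : ∀ x, τ (τ x) = x := fun x => (h x).1
  refine ⟨swapOps (Finset.univ : Finset {x // x < τ x}).toList, fun o ho => ?_, ?_,
    fun p => ⟨?_, performed_swapOps _ p⟩⟩
  · obtain ⟨x, -, rfl⟩ := List.mem_map.1 ho
    exact (h x.1).2.resolve_left x.2.ne'
  · refine List.Pairwise.map _ (fun x y hxy => ?_) (Finset.nodup_toList _)
    have hxy' : x.1 ≠ y.1 := fun h => hxy (Subtype.ext h)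
    have hx := x.2
    have hy := y.2
    refine ⟨hxy', fun e => ?_, fun e => ?_, fun e => hxy' (τ.injective e)⟩
    · change x.1 = τ y.1 at e
      rw [e, hτ] at hx
      exact lt_asymm hx hy
    · change τ x.1 = y.1 at e
      rw [← e, hτ] at hy
      exact lt_asymm hx hy
  · ext1 q
    obtain ⟨h1, h2⟩ := positions_swapOps hτ _ (Finset.nodup_toList Finset.univ) p q
    rw [trans_apply]
    rcases lt_trichotomy (p q) (τ (p q)) with hlt | heq | hgt
    · exact h1 ⟨⟨p q, hlt⟩, by simp, Or.inl rfl⟩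
    · rw [h2, ← heq]
      rintro ⟨x, -, hx | hx⟩
      · have := x.2
        rw [← hx, ← heq] at this
        exact lt_irrefl _ this
      · have := x.2
        rw [hx, hτ] at heq
        exact this.ne' heq
    · exact h1 ⟨⟨τ (p q), by rwa [hτ]⟩, by simp, Or.inr (hτ _).symm⟩

theorem exists_swap_steps {n : ℕ} {G : SimpleGraph (Fin n)} {t : ℕ} {σ : Perm (Fin n)}
    (h : Routable G t σ) : ∃ steps : List (List (Op (Fin n))), steps.length = t ∧
      (∀ S ∈ steps, ∀ o ∈ S, G.Adj o.fst o.snd) ∧ (∀ S ∈ steps, S.Pairwise Op.Disjoint) ∧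
      ∀ p : Perm (Fin n), Op.positions p steps.flatten = p.trans σ ∧
        Op.performed p steps.flatten = [] := by
  induction h with
  | zero => exact ⟨[], rfl, by simp, by simp, fun p => ⟨rfl, rfl⟩⟩
  | @succ t τ σ hτ _ ih =>
    obtain ⟨steps, hlen, h1, h2, h3⟩ := ih
    obtain ⟨S, hS1, hS2, hS3⟩ := exists_swap_layer hτ
    -- In `τ * σ` the factor `τ` acts last, so its layer is appended.
    refine ⟨steps ++ [S], by simp [hlen], fun S' hS' => ?_, fun S' hS' => ?_, fun p => ?_⟩
    · rcases List.mem_append.1 hS' with h | h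
      · exact h1 S' h
      · rw [List.mem_singleton.1 h]
        exact hS1
    · rcases List.mem_append.1 hS' with h | h
      · exact h2 S' h
      · rw [List.mem_singleton.1 h]
        exact hS2
    · rw [List.flatten_append, List.flatten_singleton, Op.positions_append, Op.performed_append,
        (h3 p).1, (h3 p).2, (hS3 _).1, (hS3 _).2]
      exact ⟨rfl, rfl⟩

/-- The time steps perform the gates `gs` and bring every qubit back to where it was. -/
structure IsBlock {n : ℕ} (G : SimpleGraph (Fin n)) (steps : List (List (Op (Fin n))))
    (gs : List (Gate (Fin n))) : Prop where
  on_edges : ∀ S ∈ steps, ∀ o ∈ S, G.Adj o.fst o.snd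
  disjoint : ∀ S ∈ steps, S.Pairwise Op.Disjoint
  positions_eq : Op.positions (Equiv.refl (Fin n)) steps.flatten = Equiv.refl (Fin n)
  performed_eq : Op.performed (Equiv.refl (Fin n)) steps.flatten = gs

theorem IsBlock.nil {n : ℕ} (G : SimpleGraph (Fin n)) : IsBlock G [] [] :=
  ⟨by simp, by simp, rfl, rfl⟩

theorem IsBlock.append {n : ℕ} {G : SimpleGraph (Fin n)} {s s' : List (List (Op (Fin n)))}
    {gs gs' : List (Gate (Fin n))} (h : IsBlock G s gs) (h' : IsBlock G s' gs') :
    IsBlock G (s ++ s') (gs ++ gs') where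
  on_edges S hS := (List.mem_append.1 hS).elim (h.on_edges S) (h'.on_edges S)
  disjoint S hS := (List.mem_append.1 hS).elim (h.disjoint S) (h'.disjoint S)
  positions_eq := by
    rw [List.flatten_append, Op.positions_append, h.positions_eq, h'.positions_eq]
  performed_eq := by
    rw [List.flatten_append, Op.performed_append, h.positions_eq, h.performed_eq, h'.performed_eq]

theorem positions_map_gate {n : ℕ} (p : Perm (Fin n)) (L : List (Gate (Fin n))) :
    Op.positions p (L.map Op.gate) = p := by
  induction L with
  | nil => rfl
  | cons g L ih => exact ih

theorem performed_map_gate {n : ℕ} (p : Perm (Fin n)) (L : List (Gate (Fin n))) :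
    Op.performed p (L.map fun g => Op.gate (g.relabel p)) = L := by
  induction L with
  | nil => rfl
  | cons g L ih =>
    refine congrArg₂ List.cons ?_ ih
    simp [Gate.relabel]

/-- Gates that a routable permutation brings to edges are performed by a block. -/
theorem exists_block_of_routable {n : ℕ} {G : SimpleGraph (Fin n)} {T : ℕ} {σ : Perm (Fin n)}
    (hσ : Routable G T σ) {L : List (Gate (Fin n))} (hL : L.Pairwise Gate.Disjoint)
    (hadj : ∀ g ∈ L, G.Adj (σ g.fst) (σ g.snd)) :
    ∃ steps, IsBlock G steps L ∧ steps.length = 2 * T + 1 := by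
  obtain ⟨s, hlen, h1, h2, h3⟩ := exists_swap_steps hσ
  obtain ⟨s', hlen', h1', h2', h3'⟩ := exists_swap_steps hσ.inv
  let S : List (Op (Fin n)) := L.map fun g => Op.gate (g.relabel σ)
  have hpos : Op.positions σ S = σ := by
    have : S = (L.map fun g => g.relabel σ).map Op.gate := by simp [S]
    rw [this, positions_map_gate]
  refine ⟨s ++ S :: s', ⟨fun S' hS' => ?_, fun S' hS' => ?_, ?_, ?_⟩, ?_⟩
  · rcases List.mem_append.1 hS' with h | h
    · exact h1 S' h
    · rcases List.mem_cons.1 h with rfl | h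
      · intro o ho
        obtain ⟨g, hg, rfl⟩ := List.mem_map.1 ho
        exact hadj g hg
      · exact h1' S' h
  · rcases List.mem_append.1 hS' with h | h
    · exact h2 S' h
    · rcases List.mem_cons.1 h with rfl | h
      · refine hL.map _ fun g g' hd => ?_
        refine ⟨fun e => ?_, fun e => ?_, fun e => ?_, fun e => ?_⟩
        · exact hd _ ⟨Or.inl rfl, Or.inl (σ.injective e).symm⟩
        · exact hd _ ⟨Or.inl rfl, Or.inr (σ.injective e).symm⟩
        · exact hd _ ⟨Or.inr rfl, Or.inl (σ.injective e).symm⟩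
        · exact hd _ ⟨Or.inr rfl, Or.inr (σ.injective e).symm⟩
      · exact h2' S' h
  · rw [List.flatten_append, List.flatten_cons, Op.positions_append, Op.positions_append,
      (h3 _).1, Equiv.refl_trans, hpos, (h3' _).1]
    ext1 q
    simp [Perm.inv_def]
  · rw [List.flatten_append, List.flatten_cons, Op.performed_append, Op.performed_append,
      (h3 _).1, (h3 _).2, Equiv.refl_trans, hpos, (h3' _).2, performed_map_gate]
    simp
  · rw [List.length_append, List.length_cons, hlen, hlen']
    omega

theorem perm_flatMap_filter {α : Type*} {R : ℕ} (κ : α → Fin R) (L : List α) :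
    ((List.finRange R).flatMap fun c => L.filter fun g => κ g = c).Perm L := by
  classical
  rw [List.perm_iff_count]
  intro a
  rw [List.count_flatMap]
  have : (List.count a ∘ fun c => L.filter fun g => κ g = c) =
      fun c => if c = κ a then L.count a else 0 := by
    funext c
    rw [Function.comp_apply]
    split_ifs with h
    · rw [List.count_filter (by simpa using h.symm)]
    · exact List.count_eq_zero_of_not_mem (by
        rw [List.mem_filter]
        rintro ⟨_, h'⟩
        exact h (Eq.symm (by simpa using h')))
  rw [this, ← Fin.sum_univ_def]
  simp

/-- The colour classes are executed one after the other, which reorders the gates of the layer. -/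
theorem exists_block_of_layer {n R T : ℕ} {G : SimpleGraph (Fin n)} (hG : RoutesPairings G R T)
    {L : List (Gate (Fin n))} (hL : L.Pairwise Gate.Disjoint) :
    ∃ steps gs, IsBlock G steps gs ∧ gs.Perm L ∧ steps.length = R * (2 * T + 1) := by
  obtain ⟨κ, hκ⟩ := hG
  have hsymm : Std.Symm (Gate.Disjoint (Q := Fin n)) := ⟨fun a b hab q hq => hab q ⟨hq.2, hq.1⟩⟩
  have key : ∀ cs : List (Fin R), ∃ steps,
      IsBlock G steps (cs.flatMap fun c => L.filter fun g => κ (g.fst, g.snd) = c) ∧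
        steps.length = cs.length * (2 * T + 1) := by
    intro cs
    induction cs with
    | nil => exact ⟨[], IsBlock.nil G, by simp⟩
    | cons c cs ih =>
      obtain ⟨s', hs', hlen'⟩ := ih
      have hLc := hL.filter fun g => κ (g.fst, g.snd) = c
      have hM : IsPairing {e | ∃ g ∈ L.filter fun g => κ (g.fst, g.snd) = c,
          e = (g.fst, g.snd)} := by
        refine ⟨?_, ?_⟩
        · rintro _ ⟨g, _, rfl⟩
          exact g.ne
        · rintro _ ⟨g, hg, rfl⟩ _ ⟨g', hg', rfl⟩ h
          by_cases hgg : g = g'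
          · rw [hgg]
          · have hd := hLc.forall hg hg' hgg
            rcases h with h | h | h | h
            · exact absurd ⟨Or.inl h, Or.inl rfl⟩ (hd g'.fst)
            · exact absurd ⟨Or.inl h, Or.inr rfl⟩ (hd g'.snd)
            · exact absurd ⟨Or.inr h, Or.inl rfl⟩ (hd g'.fst)
            · exact absurd ⟨Or.inr h, Or.inr rfl⟩ (hd g'.snd)
      obtain ⟨σ, hσ, hadj⟩ := hκ _ hM c (by
        rintro _ ⟨g, hg, rfl⟩
        simpa using (List.mem_filter.1 hg).2)
      obtain ⟨s, hs, hlen⟩ := exists_block_of_routable hσ hLc fun g hg => hadj _ ⟨g, hg, rfl⟩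
      refine ⟨s ++ s', hs.append hs', ?_⟩
      rw [List.length_append, hlen, hlen', List.length_cons]
      ring
  obtain ⟨s, hs, hlen⟩ := key (List.finRange R)
  exact ⟨s, _, hs, perm_flatMap_filter (fun g : Gate (Fin n) => κ (g.fst, g.snd)) L,
    by rw [hlen, List.length_finRange]⟩

/-- At most one gate of a layer touches a given qubit, and a list of length at most 1 is determined
by its permutation class. -/
theorem filter_touches_eq_of_perm {Q : Type*} [DecidableEq Q] {L L' : List (Gate Q)}
    (hp : L'.Perm L) (hL : L.Pairwise Gate.Disjoint) (q : Q) :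
    L'.filter (fun g => decide (g.Touches q)) = L.filter (fun g => decide (g.Touches q)) := by
  have h := hp.filter fun g => decide (g.Touches q)
  have hd := hL.filter fun g => decide (g.Touches q)
  have ht : ∀ g ∈ L.filter (fun g => decide (g.Touches q)), g.Touches q := fun g hg => by
    simpa using (List.mem_filter.1 hg).2
  generalize L.filter (fun g => decide (g.Touches q)) = l at h hd ht
  match l, h, hd, ht with
  | [], h, _, _ => exact h.eq_nil
  | [g], h, _, _ => exact List.perm_singleton.1 h
  | g :: g' :: l, _, hd, ht =>
    exact absurd ⟨ht g (by simp), ht g' (by simp)⟩ ((List.pairwise_cons.1 hd).1 g' (by simp) q)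

theorem exists_block_of_layers {n R T : ℕ} {G : SimpleGraph (Fin n)} (hG : RoutesPairings G R T)
    (layers : List (List (Gate (Fin n)))) (hL : ∀ L ∈ layers, L.Pairwise Gate.Disjoint) :
    ∃ steps gs, IsBlock G steps gs ∧
      (∀ q, gs.filter (fun g => decide (g.Touches q)) =
        layers.flatten.filter (fun g => decide (g.Touches q))) ∧
      (∀ ψ : State (Fin n), gs.foldl (fun φ g => g.apply φ) ψ =
        layers.flatten.foldl (fun φ g => g.apply φ) ψ) ∧
      steps.length = layers.length * (R * (2 * T + 1)) := by
  induction layers with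
  | nil => exact ⟨[], [], IsBlock.nil G, fun q => rfl, fun ψ => rfl, by simp⟩
  | cons L layers ih =>
    obtain ⟨s', gs', hs', hf', hψ', hlen'⟩ := ih fun L' hL' => hL L' (List.mem_cons_of_mem _ hL')
    have hLd := hL L List.mem_cons_self
    obtain ⟨s, gs, hs, hp, hlen⟩ := exists_block_of_layer hG hLd
    refine ⟨s ++ s', gs ++ gs', hs.append hs', fun q => ?_, fun ψ => ?_, ?_⟩
    · rw [List.flatten_cons, List.filter_append, List.filter_append, hf',
        filter_touches_eq_of_perm hp hLd]
    · rw [List.flatten_cons, List.foldl_append, List.foldl_append, hψ',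
        Gate.foldl_apply_perm hp.symm hLd]
    · rw [List.length_append, hlen, hlen', List.length_cons]
      ring

/-- Routing of pairings yields a compilation scheme. -/
theorem exists_scheme {n R T : ℕ} {G : SimpleGraph (Fin n)} (hG : RoutesPairings G R T) :
    ∃ χ : Scheme (Fin n) G, ∀ ζ : Circuit (Fin n),
      (∀ ψ : State (Fin n), (χ ζ).run (place (χ ζ).init ψ) = place (χ ζ).final (ζ.run ψ)) ∧
      (0 < ζ.depth → depthOverhead G ζ χ ≤ R * (2 * T + 1)) := by
  have h : ∀ ζ : Circuit (Fin n), ∃ c : Compiled G ζ,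
      (∀ ψ : State (Fin n), c.run (place c.init ψ) = place c.final (ζ.run ψ)) ∧
      c.steps.length = ζ.depth * (R * (2 * T + 1)) := by
    intro ζ
    obtain ⟨s, gs, hs, hf, hψ, hlen⟩ := exists_block_of_layers hG ζ.layers ζ.disjoint
    refine ⟨⟨Equiv.refl _, s, hs.on_edges, hs.disjoint, fun q => ?_⟩, fun ψ => ?_, hlen⟩
    · rw [hs.performed_eq]
      exact hf q
    · refine (Op.foldl_apply_place _ _ _).trans (congrArg _ ?_)
      rw [hs.performed_eq]
      exact hψ ψ
  choose χ hχ hlen using h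
  refine ⟨χ, fun ζ => ⟨hχ ζ, fun hd => ?_⟩⟩
  rw [depthOverhead, hlen, div_le_iff₀ (by exact_mod_cast hd)]
  push_cast
  exact le_of_eq (by ring)

end QRouting

/-! ### The main theorem. -/

theorem theorem3p1 (r : ℕ) (hr : 4 ≤ r) :
    ∃ C : ℝ, ∀ n : ℕ, r < n → Even (n * r) →
      ∃ (G : SimpleGraph (Fin n)) (_ : DecidableRel G.Adj) (χ : QRouting.Scheme (Fin n) G),
        G.IsRegularOfDegree r ∧
        ∀ ζ : QRouting.Circuit (Fin n),
          (∀ ψ : QRouting.State (Fin n),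
            (χ ζ).run (QRouting.place (χ ζ).init ψ) =
              QRouting.place (χ ζ).final (ζ.run ψ)) ∧
          (0 < ζ.depth → QRouting.depthOverhead G ζ χ ≤ C * Real.log n) := by
  obtain ⟨N, hN⟩ : ∃ N : ℕ, N = 8 * (2 * r * r + 3 * r) + 8 := ⟨_, rfl⟩
  -- The first summand pays for `n < N`, where `log n ≥ 1`; the second for `n ≥ N`, where `k ≤ log n
  -- / log 2`.
  let C : ℝ := (N * N : ℕ) * (2 * (4 * N : ℕ) + 1) + 64 * 97 / Real.log 2
  have hlog2 : 0 < Real.log 2 := Real.log_pos (by norm_num)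
  refine ⟨C, fun n hrn he => ?_⟩
  by_cases hn : N ≤ n
  · classical
    obtain ⟨k, G, hk, hkn, hreg, hG⟩ :=
      QRouting.exists_regular_routesPairings (n := n) hr (hN ▸ hn) he
    obtain ⟨χ, hχ⟩ := QRouting.exists_scheme hG
    refine ⟨G, inferInstance, χ, hreg, fun ζ => ⟨(hχ ζ).1, fun hd => ((hχ ζ).2 hd).trans ?_⟩⟩
    have hk1 : (1 : ℝ) ≤ k := by exact_mod_cast hk
    have hklog : k * Real.log 2 ≤ Real.log n := by
      rw [← Real.log_pow]
      exact Real.log_le_log (by positivity) (by exact_mod_cast hkn)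
    -- `2 * (16 * k + 32) + 1 = 32 * k + 65`, which is at most `97 * k` because `k ≥ 1`.
    calc ((64 : ℕ) : ℝ) * (2 * (16 * k + 32 : ℕ) + 1) ≤ 64 * 97 * k := by
          push_cast
          linarith
      _ = 64 * 97 / Real.log 2 * (k * Real.log 2) := by field_simp
      _ ≤ 64 * 97 / Real.log 2 * Real.log n := by gcongr
      _ ≤ C * Real.log n := by
          refine mul_le_mul_of_nonneg_right ?_ (Real.log_natCast_nonneg n)
          exact le_add_of_nonneg_left (by positivity)
  · obtain ⟨G, dec, hpath, hreg⟩ := QRouting.exists_regular_pathGraph_le (by omega) hrn he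
    obtain ⟨χ, hχ⟩ := QRouting.exists_scheme
      (QRouting.routesPairings_of_pathGraph_le (by omega) hpath)
    refine ⟨G, dec, χ, hreg, fun ζ => ⟨(hχ ζ).1, fun hd => ((hχ ζ).2 hd).trans ?_⟩⟩
    have hnN : n ≤ N := by omega
    have hlog : 1 ≤ Real.log n := by
      rw [Real.le_log_iff_exp_le (by exact_mod_cast (by omega : 0 < n))]
      have h4 : (4 : ℝ) ≤ n := by exact_mod_cast (by omega : 4 ≤ n)
      linarith [Real.exp_one_lt_d9]
    calc ((n * n : ℕ) : ℝ) * (2 * (4 * n : ℕ) + 1)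
        ≤ (N * N : ℕ) * (2 * (4 * N : ℕ) + 1) := by gcongr
      _ ≤ C := le_add_of_nonneg_right (by positivity)
      _ ≤ C * Real.log n := le_mul_of_one_le_right (by positivity) hlog
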